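/- Let $G:\mathbb R\to\mathbb R$ be twice continuously differentiable, not a polynomial of degree at most $2$, with $\mathrm E[G(N)]=0$ for $N\sim N(0,1)$; write $g=G'$. Let $\boldsymbol x_1,\boldsymbol x_2,\dots$ be i.i.d. with $\boldsymbol x_i=\boldsymbol\mu+\boldsymbol z_i$ (the independent component model with mixing matrix $\boldsymbol I_p$), where $\boldsymbol z_i=(z_{i1},\dots,z_{ip})^T$ has mutually independent components such that (A1) at most one component is Gaussian; (A2) $\mathrm E(z_{ij})=0$ and $\mathrm E(z_{ij}^2)=1$; (A3) the moments $\mathrm E[z_{ij}^4]$, $\nu_j=\mathrm E[G(z_{ij})]$, $\mu_j=\mathrm E[g(z_{ij})]$, $\mathrm{Var}[g(z_{ij})]$, $\lambda_j=\mathrm E[g(z_{ij})z_{ij}]$, $\delta_j=\mathrm E[g'(z_{ij})]$, $\tau_j=\mathrm E[g'(z_{ij})z_{ij}]$ exist and are finite; and, as regularity condition, for every $j$ there is $\varepsilon>0$ with $$\mathrm E\Big[(1+\|\boldsymbol z_i\|^2)\sup_{|t-z_{ij}|\le\varepsilon(1+\|\boldsymbol z_i\|)}|g'(t)|\Big]<\infty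 .$$ Let $s_j=\mathrm{sign}(\nu_j)$, and assume $\nu_j(\lambda_j-\delta_j)\ge 0$ for all $j$, with equality for at most one $j$. For the sample $\boldsymbol x_1,\dots,\boldsymbol x_n$ let $\bar{\boldsymbol x}$ be the mean, $\hat{\boldsymbol S}=\frac1n\sum_i(\boldsymbol x_i-\bar{\boldsymbol x})(\boldsymbol x_i-\bar{\boldsymbol x})^T$, $\hat\nu(\boldsymbol\gamma)=\frac1n\sum_i G(\boldsymbol\gamma^T(\boldsymbol x_i-\bar{\boldsymbol x}))$, $\hat{\boldsymbol T}(\boldsymbol\gamma)=\frac1n\sum_i g(\boldsymbol\gamma^T(\boldsymbol x_i-\bar{\boldsymbol x}))(\boldsymbol x_i-\bar{\boldsymbol x})$, $\hat{\boldsymbol T}_2(\boldsymbol\gamma)=\hat\nu(\boldsymbol\gamma)\hat{\boldsymbol T}(\boldsymbol\gamma)$. Let $\boldsymbol\Gamma=(\boldsymbol\gamma_1,\dots,\boldsymbol\gamma_p)^T$ satisfy $\boldsymbol\gamma_l^T\hat{\boldsymbol S}\boldsymbol\gamma_j=\mathbf 1\{l=j\}$ for all $j,l$. It is a solution of the deflation-based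 FastICA equations if $\hat{\boldsymbol T}(\boldsymbol\gamma_j)=\hat{\boldsymbol S}\big(\sum_{l\le j}\boldsymbol\gamma_l\boldsymbol\gamma_l^T\big)\hat{\boldsymbol T}(\boldsymbol\gamma_j)$ for all $j$; symmetric FastICA equations if $\boldsymbol\gamma_l^T\hat{\boldsymbol T}(\boldsymbol\gamma_j)\,\mathrm{sign}(\hat\nu(\boldsymbol\gamma_j))=\boldsymbol\gamma_j^T\hat{\boldsymbol T}(\boldsymbol\gamma_l)\,\mathrm{sign}(\hat\nu(\boldsymbol\gamma_l))$ for all $j,l$; squared symmetric FastICA equations if $\boldsymbol\gamma_l^T\hat{\boldsymbol T}_2(\boldsymbol\gamma_j)=\boldsymbol\gamma_j^T\hat{\boldsymbol T}_2(\boldsymbol\gamma_l)$ for all $j,l$. Put $\boldsymbol T_j=\frac1n\sum_i(g(z_{ij})-\mu_j)\boldsymbol z_i$ and $\boldsymbol T_{2j}=\big(\frac1n\sum_iG(z_{ij})\big)\boldsymbol T_j$. Then the following hold, where in each part the estimators $\hat{\boldsymbol\Gamma}=(\hat\gamma_{jl})$ are measurable functions of $\boldsymbol x_1,\dots,\boldsymbol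 x_n$ which, almost surely, solve the respective equations for all sufficiently large $n$ and converge to $\boldsymbol I_p$, and $o_P(1)$ denotes convergence to $0$ in probability as $n\to\infty$. (i) If $\lambda_j\ne\delta_j$ for all $j<p$, there are deflation-based solutions $\hat{\boldsymbol\Gamma}^d$ with $$\sqrt n\,\hat\gamma^d_{jl}=-\sqrt n\,\hat\gamma^d_{lj}-\sqrt n\,\hat S_{jl}+o_P(1)\ (l<j),\qquad \sqrt n(\hat\gamma^d_{jj}-1)=-\tfrac12\sqrt n(\hat S_{jj}-1)+o_P(1),$$ $$\sqrt n\,\hat\gamma^d_{jl}=\frac{\boldsymbol e_l^T\sqrt n\,\boldsymbol T_j-\lambda_j\sqrt n\,\hat S_{jl}}{\lambda_j-\delta_j}+o_P(1)\ (l>j).$$ (ii) If $\nu_j\neq0$ for all $j$, there are symmetric solutions $\hat{\boldsymbol\Gamma}^s$ with $\sqrt n(\hat\gamma^s_{jj}-1)=-\tfrac12\sqrt n(\hat S_{jj}-1)+o_P(1)$ and, for $l\ne j$, $$\sqrt n\,\hat\gamma^s_{jl}=\frac{\boldsymbol e_l^T\sqrt n\,\boldsymbol T_js_j-\boldsymbol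 e_j^T\sqrt n\,\boldsymbol T_ls_l-(\lambda_js_j-\delta_ls_l)\sqrt n\,\hat S_{jl}}{(\lambda_j-\delta_j)s_j+(\lambda_l-\delta_l)s_l}+o_P(1).$$ (iii) There are squared symmetric solutions $\hat{\boldsymbol\Gamma}^{s2}$ with $\sqrt n(\hat\gamma^{s2}_{jj}-1)=-\tfrac12\sqrt n(\hat S_{jj}-1)+o_P(1)$ and, for $l\neq j$, $$\sqrt n\,\hat\gamma^{s2}_{jl}=\frac{\boldsymbol e_l^T\sqrt n\,\boldsymbol T_{2j}-\boldsymbol e_j^T\sqrt n\,\boldsymbol T_{2l}+(\nu_l\delta_l-\nu_j\lambda_j)\sqrt n\,\hat S_{jl}}{\nu_j(\lambda_j-\delta_j)+\nu_l(\lambda_l-\delta_l)}+o_P(1).$$ -/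

import Mathlib

open MeasureTheory ProbabilityTheory Filter Topology Matrix

noncomputable section

namespace FastICA

/-- Admissible functions `G`: twice continuously differentiable, neither linear nor quadratic, and
with `E[G(N)] = 0` for a standard Gaussian variable `N`.  The nonlinearity is `g = deriv G`. -/
structure IsAdmissible (G : ℝ → ℝ) : Prop where
  contDiff : ContDiff ℝ 2 G
  not_quadratic : ¬ ∃ a b c : ℝ, ∀ t, G t = a * t ^ 2 + b * t + c
  integrable_gaussian : Integrable G (gaussianReal 0 1)
  integral_gaussian : ∫ t, G t ∂(gaussianReal 0 1) = 0

section Population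

variable {Ω : Type*} [MeasurableSpace Ω] {p : ℕ}

/-- `x 0, x 1, …` is an i.i.d. sample from the independent component model `x = loc + A z`
with full-rank mixing matrix `A`: `z 0, z 1, …` are i.i.d. copies of a random vector with mutually
independent components. -/
structure IsICSample (P : Measure Ω) (loc : Fin p → ℝ) (A : Matrix (Fin p) (Fin p) ℝ)
    (x z : ℕ → Ω → Fin p → ℝ) : Prop where
  isUnit_det : IsUnit A.det
  model : ∀ i ω, x i ω = loc + A *ᵥ z i ω
  measurable : ∀ i, Measurable (z i)
  indep_sample : iIndepFun z P
  identDistrib : ∀ i, IdentDistrib (z i) (z 0) P P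
  indep_components : iIndepFun (fun (j : Fin p) ω => z 0 ω j) P

/-- (A1): at most one component is Gaussian. -/
def AtMostOneGaussian (P : Measure Ω) (z : Ω → Fin p → ℝ) : Prop :=
  {j : Fin p | ∃ (m : ℝ) (v : NNReal), P.map (fun ω => z ω j) = gaussianReal m v}.Subsingleton

/-- (A2): every component is square integrable with mean `0` and second moment `1`. -/
def IsStandardized (P : Measure Ω) (z : Ω → Fin p → ℝ) : Prop :=
  ∀ j, MemLp (fun ω => z ω j) 2 P ∧ ∫ ω, z ω j ∂P = 0 ∧ ∫ ω, z ω j ^ 2 ∂P = 1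

/-- (A3): the fourth moments and the expected values `ν, μ, σ², λ, δ, τ` exist. -/
structure HasMoments (P : Measure Ω) (G : ℝ → ℝ) (z : Ω → Fin p → ℝ) : Prop where
  beta : ∀ j, Integrable (fun ω => z ω j ^ 4) P
  nu : ∀ j, Integrable (fun ω => G (z ω j)) P
  mu : ∀ j, Integrable (fun ω => deriv G (z ω j)) P
  sigma : ∀ j, Integrable (fun ω => deriv G (z ω j) ^ 2) P
  lam : ∀ j, Integrable (fun ω => deriv G (z ω j) * z ω j) P
  delta : ∀ j, Integrable (fun ω => deriv (deriv G) (z ω j)) P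
  tau : ∀ j, Integrable (fun ω => deriv (deriv G) (z ω j) * z ω j) P

/-- Local domination of the second-order term of the Taylor expansion: for some `ε > 0`, the variable
`(1 + ‖z‖²) sup {|g'(t)| : |t - z_j| ≤ ε (1 + ‖z‖)}` has an integrable upper bound. -/
def IsLocallyDominated (P : Measure Ω) (G : ℝ → ℝ) (z : Ω → Fin p → ℝ) : Prop :=
  ∀ j, ∃ ε > 0, ∃ H : (Fin p → ℝ) → ℝ, Measurable H ∧ Integrable (fun ω => H (z ω)) P ∧
    ∀ y t, |t - y j| ≤ ε * (1 + ‖y‖) → |deriv (deriv G) t| * (1 + ‖y‖ ^ 2) ≤ H y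

/-- `ν_j = E[G(z_j)]` -/
def nu (P : Measure Ω) (G : ℝ → ℝ) (z : Ω → Fin p → ℝ) (j : Fin p) : ℝ :=
  ∫ ω, G (z ω j) ∂P

/-- `μ_j = E[g(z_j)]` -/
def mu (P : Measure Ω) (G : ℝ → ℝ) (z : Ω → Fin p → ℝ) (j : Fin p) : ℝ :=
  ∫ ω, deriv G (z ω j) ∂P

/-- `λ_j = E[g(z_j) z_j]` -/
def lam (P : Measure Ω) (G : ℝ → ℝ) (z : Ω → Fin p → ℝ) (j : Fin p) : ℝ :=
  ∫ ω, deriv G (z ω j) * z ω j ∂P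

/-- `δ_j = E[g'(z_j)]` -/
def del (P : Measure Ω) (G : ℝ → ℝ) (z : Ω → Fin p → ℝ) (j : Fin p) : ℝ :=
  ∫ ω, deriv (deriv G) (z ω j) ∂P

/-- `s_j = sign(ν_j)` -/
def sgn (P : Measure Ω) (G : ℝ → ℝ) (z : Ω → Fin p → ℝ) (j : Fin p) : ℝ :=
  Real.sign (nu P G z j)

end Population

section Sample

variable {n p : ℕ}

/-- The sample mean vector. -/
def sampleMean (X : Fin n → Fin p → ℝ) : Fin p → ℝ :=
  fun k => (n : ℝ)⁻¹ * ∑ i, X i k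

/-- The covariance matrix of the empirical distribution. -/
def sampleCov (X : Fin n → Fin p → ℝ) : Matrix (Fin p) (Fin p) ℝ :=
  Matrix.of fun k l =>
    (n : ℝ)⁻¹ * ∑ i, (X i k - sampleMean X k) * (X i l - sampleMean X l)

/-- The sample average of `G(γᵀ(x_i - x̄))`. -/
def hatG (G : ℝ → ℝ) (X : Fin n → Fin p → ℝ) (γ : Fin p → ℝ) : ℝ :=
  (n : ℝ)⁻¹ * ∑ i, G (γ ⬝ᵥ (X i - sampleMean X))

/-- The sample average of `g(γᵀ(x_i - x̄)) (x_i - x̄)`. -/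
def hatT (G : ℝ → ℝ) (X : Fin n → Fin p → ℝ) (γ : Fin p → ℝ) : Fin p → ℝ :=
  (n : ℝ)⁻¹ • ∑ i, deriv G (γ ⬝ᵥ (X i - sampleMean X)) • (X i - sampleMean X)

/-- The squared-symmetric analogue of `hatT`. -/
def hatT2 (G : ℝ → ℝ) (X : Fin n → Fin p → ℝ) (γ : Fin p → ℝ) : Fin p → ℝ :=
  hatG G X γ • hatT G X γ

/-- `γ_lᵀ Ŝ γ_j = δ_lj`, where `γ_j` is the `j`-th row of `Γ`. -/
def IsWhitening (X : Fin n → Fin p → ℝ) (Γ : Matrix (Fin p) (Fin p) ℝ) : Prop :=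
  ∀ j l, Γ l ⬝ᵥ (sampleCov X *ᵥ Γ j) = if l = j then 1 else 0

/-- Deflation-based FastICA: the estimating equations, together with the constraint under which
the rows are extracted. -/
def IsDeflationSolution (G : ℝ → ℝ) (X : Fin n → Fin p → ℝ)
    (Γ : Matrix (Fin p) (Fin p) ℝ) : Prop :=
  (∀ j, hatT G X (Γ j) =
    sampleCov X *ᵥ ((∑ l ∈ Finset.Iic j, vecMulVec (Γ l) (Γ l)) *ᵥ hatT G X (Γ j))) ∧
  IsWhitening X Γ

/-- Symmetric FastICA: the estimating equations, with the empirical signs. -/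
def IsSymmetricSolution (G : ℝ → ℝ) (X : Fin n → Fin p → ℝ)
    (Γ : Matrix (Fin p) (Fin p) ℝ) : Prop :=
  (∀ j l, (Γ l ⬝ᵥ hatT G X (Γ j)) * Real.sign (hatG G X (Γ j)) =
    (Γ j ⬝ᵥ hatT G X (Γ l)) * Real.sign (hatG G X (Γ l))) ∧
  IsWhitening X Γ

/-- Squared symmetric FastICA: the estimating equations. -/
def IsSquaredSymmetricSolution (G : ℝ → ℝ) (X : Fin n → Fin p → ℝ)
    (Γ : Matrix (Fin p) (Fin p) ℝ) : Prop :=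
  (∀ j l, Γ l ⬝ᵥ hatT2 G X (Γ j) = Γ j ⬝ᵥ hatT2 G X (Γ l)) ∧ IsWhitening X Γ

/-- `T_j = n⁻¹ ∑ (g(z_ij) - μ_j) z_i`, for a source sample `Z` and a number `m` in place of `μ_j`. -/
def srcT (G : ℝ → ℝ) (m : ℝ) (Z : Fin n → Fin p → ℝ) (j : Fin p) : Fin p → ℝ :=
  (n : ℝ)⁻¹ • ∑ i, (deriv G (Z i j) - m) • Z i

/-- `T_{2j} = (n⁻¹ ∑ G(z_ij)) T_j`. -/
def srcT2 (G : ℝ → ℝ) (m : ℝ) (Z : Fin n → Fin p → ℝ) (j : Fin p) : Fin p → ℝ :=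
  ((n : ℝ)⁻¹ * ∑ i, G (Z i j)) • srcT G m Z j

end Sample

section Asymptotics

variable {Ω : Type*} [MeasurableSpace Ω] {p : ℕ}

/-- The first `n` observations of a sequence. -/
def firstObs (x : ℕ → Ω → Fin p → ℝ) (n : ℕ) (ω : Ω) : Fin n → Fin p → ℝ :=
  fun i => x i ω

/-- `R_n = o_P(1)`. -/
def IsLittleOP (P : Measure Ω) (R : ℕ → Ω → ℝ) : Prop :=
  TendstoInMeasure P R atTop (fun _ => 0)

/-- `est` is a sequence of measurable estimators which, almost surely, solves the estimating
equations `Sol` for all large `n` and converges to the identity matrix. -/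
def IsConsistentSolution (P : Measure Ω) (x : ℕ → Ω → Fin p → ℝ)
    (Sol : ∀ n : ℕ, (Fin n → Fin p → ℝ) → Matrix (Fin p) (Fin p) ℝ → Prop)
    (est : ∀ n : ℕ, (Fin n → Fin p → ℝ) → Matrix (Fin p) (Fin p) ℝ) : Prop :=
  (∀ n j l, Measurable fun X => est n X j l) ∧
  ∀ᵐ ω ∂P, (∀ᶠ n in atTop, Sol n (firstObs x n ω) (est n (firstObs x n ω))) ∧
    ∀ j l, Tendsto (fun n => est n (firstObs x n ω) j l) atTop
      (𝓝 ((1 : Matrix (Fin p) (Fin p) ℝ) j l))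

end Asymptotics

end FastICA

end

/-!
All three sets of equations have the identity matrix as population solution. Almost surely the
sample equations, as functions of `Γ`, converge at the identity, and their increments are linear up
to an error that is small uniformly over all large `n` near the identity. Hence the Newton
iteration preconditioned by the inverse of the *population* derivative contracts a fixed ball
around the identity for all large `n`; its limit solves the sample equations and depends measurably
on the data. The limit differs from the first Newton step by `o(R n)`, where `R n` is the
fluctuation of the sample averages entering the equations at the identity, and that step gives the
stated expansions explicitly. As the averages are those of centred square integrable variables,
`√n R n` is bounded in probability, which turns `√n o(R n)` into `o_P(1)`.
-/

open Asymptotics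

noncomputable section

namespace FastICA

section UniformStrictDerivative

variable {ι 𝕜 E F H : Type*} [NontriviallyNormedField 𝕜] [NormedAddCommGroup E] [NormedSpace 𝕜 E]
  [NormedAddCommGroup F] [NormedSpace 𝕜 F] [NormedAddCommGroup H] [NormedSpace 𝕜 H]

/-- The maps `f i` converge at `x₀` to `c` along `l`, and in the limit they are strictly
differentiable at `x₀` with derivative `L`: the remainder `f i x - f i y - L (x - y)` is
`o(x - y)` as `i` tends to `l` and `x, y → x₀` jointly.  This is what a random criterion retains of
the differentiability of its deterministic limit. -/
structure HasUnifStrictFDerivAt (l : Filter ι) (f : ι → E → F) (c : F) (L : E →L[𝕜] F)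
    (x₀ : E) : Prop where
  tendsto : Tendsto (fun i => f i x₀) l (𝓝 c)
  isLittleO : (fun q : ι × E × E => f q.1 q.2.1 - f q.1 q.2.2 - L (q.2.1 - q.2.2))
    =o[l ×ˢ 𝓝 (x₀, x₀)] fun q => q.2.1 - q.2.2

theorem tendsto_fst_prodMk_fst (l : Filter ι) (x₀ : E) :
    Tendsto (fun q : ι × E × E => (q.1, q.2.1)) (l ×ˢ 𝓝 (x₀, x₀)) (l ×ˢ 𝓝 x₀) :=
  tendsto_fst.prodMk ((continuous_fst.tendsto (x₀, x₀)).comp tendsto_snd)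

theorem tendsto_fst_prodMk_snd (l : Filter ι) (x₀ : E) :
    Tendsto (fun q : ι × E × E => (q.1, q.2.2)) (l ×ˢ 𝓝 (x₀, x₀)) (l ×ˢ 𝓝 x₀) :=
  tendsto_fst.prodMk ((continuous_snd.tendsto (x₀, x₀)).comp tendsto_snd)

namespace HasUnifStrictFDerivAt

variable {l : Filter ι} {f g : ι → E → F} {c d : F} {L M : E →L[𝕜] F} {x₀ : E}

theorem isBigO (h : HasUnifStrictFDerivAt l f c L x₀) :
    (fun q : ι × E × E => f q.1 q.2.1 - f q.1 q.2.2)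
      =O[l ×ˢ 𝓝 (x₀, x₀)] fun q => q.2.1 - q.2.2 := by
  have hL : (fun q : ι × E × E => L (q.2.1 - q.2.2)) =O[l ×ˢ 𝓝 (x₀, x₀)]
      fun q => q.2.1 - q.2.2 := L.isBigO_comp _ _
  simpa only [sub_add_cancel] using h.isLittleO.isBigO.add hL

theorem tendsto_prod (h : HasUnifStrictFDerivAt l f c L x₀) :
    Tendsto (fun q : ι × E => f q.1 q.2) (l ×ˢ 𝓝 x₀) (𝓝 c) := by
  have hdiag : Tendsto (fun q : ι × E => (q.1, q.2, x₀)) (l ×ˢ 𝓝 x₀) (l ×ˢ 𝓝 (x₀, x₀)) :=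
    tendsto_fst.prodMk (tendsto_snd.prodMk_nhds tendsto_const_nhds)
  have harg : Tendsto (fun q : ι × E => q.2 - x₀) (l ×ˢ 𝓝 x₀) (𝓝 0) :=
    tendsto_sub_nhds_zero_iff.2 tendsto_snd
  have hval : Tendsto (fun q : ι × E => f q.1 x₀) (l ×ˢ 𝓝 x₀) (𝓝 c) :=
    h.tendsto.comp tendsto_fst
  simpa [Function.comp_def] using ((h.isBigO.comp_tendsto hdiag).trans_tendsto harg).add hval

theorem tendsto_comp (h : HasUnifStrictFDerivAt l f c L x₀) {u : ι → E}
    (hu : Tendsto u l (𝓝 x₀)) : Tendsto (fun i => f i (u i)) l (𝓝 c) :=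
  h.tendsto_prod.comp (tendsto_id.prodMk hu)

theorem isLittleO_comp (h : HasUnifStrictFDerivAt l f c L x₀) {u v : ι → E}
    (hu : Tendsto u l (𝓝 x₀)) (hv : Tendsto v l (𝓝 x₀)) :
    (fun i => f i (u i) - f i (v i) - L (u i - v i)) =o[l] fun i => u i - v i :=
  h.isLittleO.comp_tendsto (tendsto_id.prodMk (hu.prodMk_nhds hv))

theorem eventually_approximatesLinearOn (h : HasUnifStrictFDerivAt l f c L x₀) {C : NNReal}
    (hC : 0 < C) :
    ∃ r > 0, ∀ᶠ i in l, ApproximatesLinearOn (f i) L (Metric.closedBall x₀ r) C := by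
  obtain ⟨A, hA, B, hB, hAB⟩ := eventually_prod_iff.1 (h.isLittleO.def (NNReal.coe_pos.2 hC))
  obtain ⟨r, hr, hrB⟩ := Metric.nhds_basis_closedBall.eventually_iff.1 hB
  refine ⟨r, hr, hA.mono fun i hi x hx y hy => hAB (y := (x, y)) hi (hrB ?_)⟩
  rw [← closedBall_prod_same]
  exact ⟨hx, hy⟩

theorem congr_deriv (h : HasUnifStrictFDerivAt l f c L x₀) {c' : F} {L' : E →L[𝕜] F} (hc : c = c')
    (hL : ∀ x, L x = L' x) : HasUnifStrictFDerivAt l f c' L' x₀ := by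
  obtain rfl : L = L' := ContinuousLinearMap.ext hL
  exact hc ▸ h

theorem clm (l : Filter ι) (L : E →L[𝕜] F) (x₀ : E) :
    HasUnifStrictFDerivAt l (fun _ x => L x) (L x₀) L x₀ :=
  ⟨tendsto_const_nhds, by simp⟩

theorem of_tendsto {u : ι → F} (hu : Tendsto u l (𝓝 c)) :
    HasUnifStrictFDerivAt l (fun i _ => u i) c (0 : E →L[𝕜] F) x₀ :=
  ⟨hu, by simp⟩

theorem sub (hf : HasUnifStrictFDerivAt l f c L x₀) (hg : HasUnifStrictFDerivAt l g d M x₀) :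
    HasUnifStrictFDerivAt l (fun i x => f i x - g i x) (c - d) (L - M) x₀ := by
  refine ⟨hf.tendsto.sub hg.tendsto, (hf.isLittleO.sub hg.isLittleO).congr_left fun q => ?_⟩
  simp only [_root_.sub_apply]
  abel

theorem sum {κ : Type*} {s : Finset κ} {f : κ → ι → E → F} {c : κ → F} {L : κ → E →L[𝕜] F}
    (h : ∀ k ∈ s, HasUnifStrictFDerivAt l (f k) (c k) (L k) x₀) :
    HasUnifStrictFDerivAt l (fun i x => ∑ k ∈ s, f k i x) (∑ k ∈ s, c k) (∑ k ∈ s, L k) x₀ := by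
  refine ⟨tendsto_finsetSum _ fun k hk => (h k hk).tendsto,
    (IsLittleO.sum fun k hk => (h k hk).isLittleO).congr_left fun q => ?_⟩
  simp [Finset.sum_sub_distrib]

theorem const_mul {f : ι → E → 𝕜} {c : 𝕜} {L : E →L[𝕜] 𝕜} (h : HasUnifStrictFDerivAt l f c L x₀)
    (a : 𝕜) : HasUnifStrictFDerivAt l (fun i x => a * f i x) (a * c) (a • L) x₀ := by
  refine ⟨h.tendsto.const_mul a, (h.isLittleO.const_mul_left a).congr_left fun q => ?_⟩
  simp only [_root_.smul_apply, smul_eq_mul]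
  ring

theorem mul {f g : ι → E → 𝕜} {c d : 𝕜} {L M : E →L[𝕜] 𝕜}
    (hf : HasUnifStrictFDerivAt l f c L x₀) (hg : HasUnifStrictFDerivAt l g d M x₀) :
    HasUnifStrictFDerivAt l (fun i x => f i x * g i x) (c * d) (c • M + d • L) x₀ := by
  refine ⟨hf.tendsto.mul hg.tendsto, ?_⟩
  have hf₀ : Tendsto (fun q : ι × E × E => f q.1 q.2.1 - c) (l ×ˢ 𝓝 (x₀, x₀)) (𝓝 0) :=
    tendsto_sub_nhds_zero_iff.2 (hf.tendsto_prod.comp (tendsto_fst_prodMk_fst l x₀))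
  have hg₀ : Tendsto (fun q : ι × E × E => g q.1 q.2.2 - d) (l ×ˢ 𝓝 (x₀, x₀)) (𝓝 0) :=
    tendsto_sub_nhds_zero_iff.2 (hg.tendsto_prod.comp (tendsto_fst_prodMk_snd l x₀))
  have hfg := ((isLittleO_one_iff ℝ).2 hf₀).mul_isBigO hg.isBigO.norm_right
  have hgf := ((isLittleO_one_iff ℝ).2 hg₀).mul_isBigO hf.isBigO.norm_right
  have hlin := (hg.isLittleO.norm_right.const_mul_left c).add
    (hf.isLittleO.norm_right.const_mul_left d)
  simp only [one_mul] at hfg hgf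
  refine (((hfg.add hgf).add hlin).of_norm_right).congr_left fun q => ?_
  simp only [_root_.add_apply, _root_.smul_apply, smul_eq_mul]
  ring

theorem pi {κ : Type*} [Fintype κ] {F : κ → Type*} [∀ k, NormedAddCommGroup (F k)]
    [∀ k, NormedSpace 𝕜 (F k)] {f : ι → E → ∀ k, F k} {c : ∀ k, F k} {L : E →L[𝕜] ∀ k, F k}
    (h : ∀ k, HasUnifStrictFDerivAt l (fun i x => f i x k) (c k)
      ((ContinuousLinearMap.proj k).comp L) x₀) : HasUnifStrictFDerivAt l f c L x₀ :=
  ⟨tendsto_pi_nhds.2 fun k => (h k).tendsto, isLittleO_pi.2 fun k => (h k).isLittleO⟩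

theorem comp {g : ι → F → H} {d : H} {M : F →L[𝕜] H} (hg : HasUnifStrictFDerivAt l g d M c)
    (hf : HasUnifStrictFDerivAt l f c L x₀) :
    HasUnifStrictFDerivAt l (fun i x => g i (f i x)) d (M.comp L) x₀ := by
  refine ⟨hg.tendsto_comp hf.tendsto, ?_⟩
  have hpair : Tendsto (fun q : ι × E × E => (q.1, f q.1 q.2.1, f q.1 q.2.2))
      (l ×ˢ 𝓝 (x₀, x₀)) (l ×ˢ 𝓝 (c, c)) :=
    tendsto_fst.prodMk ((hf.tendsto_prod.comp (tendsto_fst_prodMk_fst l x₀)).prodMk_nhds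
      (hf.tendsto_prod.comp (tendsto_fst_prodMk_snd l x₀)))
  have houter := (hg.isLittleO.comp_tendsto hpair).trans_isBigO hf.isBigO
  have hinner := (M.isBigO_comp (fun q : ι × E × E =>
    f q.1 q.2.1 - f q.1 q.2.2 - L (q.2.1 - q.2.2)) (l ×ˢ 𝓝 (x₀, x₀))).trans_isLittleO hf.isLittleO
  refine (houter.add hinner).congr_left fun q => ?_
  simp only [Function.comp_apply, ContinuousLinearMap.comp_apply, map_sub]
  abel

end HasUnifStrictFDerivAt

section SimplifiedNewton

variable [CompleteSpace E]

theorem exists_zero_of_approximatesLinearOn_id {f : E → E} {x₀ : E} {r : ℝ} {C : NNReal}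
    (hf : ApproximatesLinearOn f (.id 𝕜 E) (Metric.closedBall x₀ r) C) (hC : C < 1)
    (h₀ : ‖f x₀‖ ≤ (1 - C) * r) :
    ∃ y, f y = 0 ∧ Tendsto (fun k => (fun x => x - f x)^[k] x₀) atTop (𝓝 y) ∧
      (1 - C) * ‖y - x₀‖ ≤ ‖f x₀‖ := by
  set K : E → E := fun x => x - f x with hK
  set s := Metric.closedBall x₀ r with hs
  have hC' : 0 < 1 - (C : ℝ) := sub_pos.2 (by exact_mod_cast hC)
  have hx₀ : x₀ ∈ s :=
    Metric.mem_closedBall_self (nonneg_of_mul_nonneg_right ((norm_nonneg _).trans h₀) hC')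
  have hlip : ∀ x ∈ s, ∀ y ∈ s, ‖K x - K y‖ ≤ C * ‖x - y‖ := fun x hx y hy =>
    calc ‖K x - K y‖ = ‖f x - f y - (x - y)‖ := by rw [← norm_neg]; congr 1; simp only [hK]; abel
      _ ≤ C * ‖x - y‖ := hf x hx y hy
  have hstep : ∀ x ∈ s, ‖K x - x₀‖ ≤ C * ‖x - x₀‖ + ‖f x₀‖ := fun x hx =>
    calc ‖K x - x₀‖ = ‖(K x - K x₀) - f x₀‖ := by congr 1; simp only [hK]; abel
      _ ≤ ‖K x - K x₀‖ + ‖f x₀‖ := norm_sub_le _ _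
      _ ≤ C * ‖x - x₀‖ + ‖f x₀‖ := by gcongr; exact hlip x hx x₀ hx₀
  have hmaps : Set.MapsTo K s s := fun x hx => by
    have hxr : ‖x - x₀‖ ≤ r := mem_closedBall_iff_norm.1 hx
    rw [hs, mem_closedBall_iff_norm]
    nlinarith [hstep x hx, C.coe_nonneg]
  have hcontr : ContractingWith C (hmaps.restrict K s s) :=
    ⟨hC, LipschitzWith.of_dist_le_mul fun x y => by
      rw [Subtype.dist_eq, Subtype.dist_eq, dist_eq_norm, dist_eq_norm]
      exact hlip x x.2 y y.2⟩
  obtain ⟨y, hys, hfix, hlim, -⟩ := hcontr.exists_fixedPoint'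
    Metric.isClosed_closedBall.isComplete hmaps hx₀ (edist_ne_top _ _)
  refine ⟨y, by simpa [hK] using hfix.eq, hlim, ?_⟩
  have hy := hstep y hys
  rw [hfix.eq] at hy
  linarith

theorem exists_zero_of_hasUnifStrictFDerivAt_id {l : Filter ι} {f : ι → E → E} {x₀ : E}
    (h : HasUnifStrictFDerivAt l f 0 (.id 𝕜 E) x₀) :
    ∃ y : ι → E, (∀ᶠ i in l, f i (y i) = 0 ∧
        Tendsto (fun k => (fun x => x - f i x)^[k] x₀) atTop (𝓝 (y i))) ∧
      Tendsto y l (𝓝 x₀) ∧ (fun i => y i - x₀ + f i x₀) =o[l] fun i => f i x₀ := by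
  obtain ⟨r, hr, happrox⟩ := h.eventually_approximatesLinearOn (C := 1 / 2) (by norm_num)
  have hsmall : ∀ᶠ i in l, ‖f i x₀‖ < r / 2 :=
    (tendsto_zero_iff_norm_tendsto_zero.1 h.tendsto).eventually_lt_const (by positivity)
  have hzero : ∀ᶠ i in l, ∃ y, f i y = 0 ∧
      Tendsto (fun k => (fun x => x - f i x)^[k] x₀) atTop (𝓝 y) ∧ ‖y - x₀‖ ≤ 2 * ‖f i x₀‖ := by
    filter_upwards [happrox, hsmall] with i hi hi₀
    obtain ⟨y, hfy, hlim, hy⟩ := exists_zero_of_approximatesLinearOn_id hi (by norm_num)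
      (by push_cast; linarith)
    push_cast at hy
    exact ⟨y, hfy, hlim, by linarith⟩
  choose! y hy using fun i (hi : ∃ y, f i y = 0 ∧
    Tendsto (fun k => (fun x => x - f i x)^[k] x₀) atTop (𝓝 y) ∧ ‖y - x₀‖ ≤ 2 * ‖f i x₀‖) => hi
  have hO : (fun i => y i - x₀) =O[l] fun i => f i x₀ :=
    IsBigO.of_bound 2 (hzero.mono fun i hi => (hy i hi).2.2)
  have hlim : Tendsto y l (𝓝 x₀) := tendsto_sub_nhds_zero_iff.1 (hO.trans_tendsto h.tendsto)
  refine ⟨y, hzero.mono fun i hi => ⟨(hy i hi).1, (hy i hi).2.1⟩, hlim, ?_⟩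
  refine (((h.isLittleO_comp hlim tendsto_const_nhds).trans_isBigO hO).neg_left).congr' ?_
    EventuallyEq.rfl
  filter_upwards [hzero] with i hi
  simp only [(hy i hi).1, ContinuousLinearMap.id_apply]
  abel

end SimplifiedNewton

end UniformStrictDerivative

section EmpiricalMeans

/-- The mean of the first `n` terms of a sequence (`0` for `n = 0`), the common form of all the
sample averages below. -/
def empMean {E : Type*} [NormedAddCommGroup E] [NormedSpace ℝ E] (u : ℕ → E) (n : ℕ) : E :=
  (n : ℝ)⁻¹ • ∑ i ∈ Finset.range n, u i

variable {E F : Type*} [NormedAddCommGroup E] [NormedSpace ℝ E] [NormedAddCommGroup F]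
  [NormedSpace ℝ F]

theorem map_empMean (L : E →ₗ[ℝ] F) (u : ℕ → E) (n : ℕ) :
    L (empMean u n) = empMean (fun i => L (u i)) n := by
  simp only [empMean, map_smul, map_sum]

theorem empMean_apply {κ : Type*} [Fintype κ] (u : ℕ → κ → E) (n : ℕ) (k : κ) :
    empMean u n k = empMean (fun i => u i k) n :=
  map_empMean (LinearMap.proj k) u n

theorem empMean_prodMk (u : ℕ → E) (v : ℕ → F) (n : ℕ) :
    empMean (fun i => (u i, v i)) n = (empMean u n, empMean v n) :=
  Prod.ext (map_empMean (LinearMap.fst ℝ E F) (fun i => (u i, v i)) n)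
    (map_empMean (LinearMap.snd ℝ E F) (fun i => (u i, v i)) n)

theorem empMean_sub (u v : ℕ → E) (n : ℕ) :
    empMean (fun i => u i - v i) n = empMean u n - empMean v n := by
  simp only [empMean, Finset.sum_sub_distrib, smul_sub]

theorem empMean_const (c : E) {n : ℕ} (hn : n ≠ 0) : empMean (fun _ => c) n = c := by
  rw [empMean, Finset.sum_const, Finset.card_range, ← Nat.cast_smul_eq_nsmul ℝ, smul_smul,
    inv_mul_cancel₀ (Nat.cast_ne_zero.2 hn), one_smul]

theorem empMean_eq_smul_sum_fin (u : ℕ → E) (n : ℕ) :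
    empMean u n = (n : ℝ)⁻¹ • ∑ i : Fin n, u i := by
  rw [empMean, Fin.sum_univ_eq_sum_range]

theorem isBigO_empMean_comp (L : E →L[ℝ] F) (u : ℕ → E) :
    empMean (fun i => L (u i)) =O[atTop] empMean u :=
  (L.isBigO_comp (empMean u) atTop).congr_left fun n => map_empMean L.toLinearMap u n

theorem norm_empMean_le {u : ℕ → E} {w : ℕ → ℝ} (h : ∀ i, ‖u i‖ ≤ w i) (n : ℕ) :
    ‖empMean u n‖ ≤ empMean w n := by
  rw [empMean, norm_smul, norm_inv, Real.norm_natCast]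
  exact mul_le_mul_of_nonneg_left (norm_sum_le_of_le _ fun i _ => h i) (by positivity)

theorem hasUnifStrictFDerivAt_empMean {Θ : Type*} [NormedAddCommGroup Θ] [NormedSpace ℝ Θ]
    {f : ℕ → Θ → E} {f' : ℕ → Θ → Θ →L[ℝ] E} {c : E}
    {L : Θ →L[ℝ] E} {θ₀ : Θ} (hf : ∀ i θ, HasFDerivAt (f i) (f' i θ) θ)
    (hc : Tendsto (empMean fun i => f i θ₀) atTop (𝓝 c))
    (hL : Tendsto (empMean fun i => f' i θ₀) atTop (𝓝 L))
    (hosc : ∀ ε > 0, ∃ r > 0, ∃ w : ℕ → ℝ,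
      (∀ i, ∀ θ ∈ Metric.closedBall θ₀ r, ‖f' i θ - f' i θ₀‖ ≤ w i) ∧
        ∀ᶠ n in atTop, empMean w n ≤ ε) :
    HasUnifStrictFDerivAt atTop (fun n θ => empMean (fun i => f i θ) n) c L θ₀ := by
  refine ⟨hc, IsLittleO.of_bound fun ε hε => ?_⟩
  obtain ⟨r, hr, w, hw, hwε⟩ := hosc (ε / 2) (half_pos hε)
  have hLε : ∀ᶠ n in atTop, ‖empMean (fun i => f' i θ₀) n - L‖ ≤ ε / 2 :=
    (tendsto_iff_norm_sub_tendsto_zero.1 hL).eventually_le_const (half_pos hε)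
  have hball : ∀ᶠ θ in 𝓝 θ₀, θ ∈ Metric.closedBall θ₀ r := Metric.closedBall_mem_nhds _ hr
  have hball₂ : ∀ᶠ q : Θ × Θ in 𝓝 (θ₀, θ₀),
      q.1 ∈ Metric.closedBall θ₀ r ∧ q.2 ∈ Metric.closedBall θ₀ r := by
    rw [nhds_prod_eq]
    exact hball.prod_mk hball
  filter_upwards [(hwε.and hLε).prod_mk hball₂]
  rintro ⟨n, a, b⟩ ⟨⟨hwn, hLn⟩, ha, hb⟩
  simp only at hwn hLn ha hb ⊢
  set D := empMean (fun i => f' i θ₀) n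
  have hterm : ∀ i, ‖f i a - f i b - f' i θ₀ (a - b)‖ ≤ ‖a - b‖ * w i := fun i =>
    mul_comm (w i) _ ▸ Convex.norm_image_sub_le_of_norm_hasFDerivWithin_le'
      (fun θ _ => (hf i θ).hasFDerivWithinAt) (hw i) (convex_closedBall _ _) hb ha
  have hsplit : empMean (fun i => f i a) n - empMean (fun i => f i b) n - L (a - b)
      = empMean (fun i => f i a - f i b - f' i θ₀ (a - b)) n + (D - L) (a - b) := by
    have hDapply : D (a - b) = empMean (fun i => f' i θ₀ (a - b)) n :=
      map_empMean (ContinuousLinearMap.apply ℝ E (a - b)).toLinearMap _ n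
    rw [empMean_sub, empMean_sub, _root_.sub_apply, hDapply]
    abel
  calc _ = _ := by rw [hsplit]
    _ ≤ ‖empMean (fun i => f i a - f i b - f' i θ₀ (a - b)) n‖ + ‖(D - L) (a - b)‖ :=
        norm_add_le _ _
    _ ≤ ‖a - b‖ * empMean w n + ‖D - L‖ * ‖a - b‖ := by
        refine add_le_add ((norm_empMean_le hterm n).trans_eq ?_) ((D - L).le_opNorm _)
        exact (map_empMean (LinearMap.mulLeft ℝ ‖a - b‖) w n).symm
    _ ≤ ‖a - b‖ * (ε / 2) + ε / 2 * ‖a - b‖ := by gcongr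
    _ = ε * ‖a - b‖ := by ring

end EmpiricalMeans

section Oscillation

variable {Θ V : Type*} [PseudoMetricSpace Θ] [SeminormedAddCommGroup V]

/-- The oscillation `sup ‖f θ - f θ₀‖` of `f` on the closed ball of radius `r` about `θ₀`. -/
def osc (f : Θ → V) (θ₀ : Θ) (r : ℝ) : ℝ :=
  sSup ((fun θ => ‖f θ - f θ₀‖) '' Metric.closedBall θ₀ r)

variable {f : Θ → V} {θ₀ : Θ} {r : ℝ}

theorem osc_nonneg : 0 ≤ osc f θ₀ r :=
  Real.sSup_nonneg (by rintro _ ⟨θ, -, rfl⟩; exact norm_nonneg _)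

theorem osc_le {C : ℝ} (hC : 0 ≤ C) (h : ∀ θ ∈ Metric.closedBall θ₀ r, ‖f θ - f θ₀‖ ≤ C) :
    osc f θ₀ r ≤ C :=
  Real.sSup_le (by rintro _ ⟨θ, hθ, rfl⟩; exact h θ hθ) hC

theorem tendsto_osc (hf : ContinuousAt f θ₀) {r : ℕ → ℝ} (hr : Tendsto r atTop (𝓝 0)) :
    Tendsto (fun m => osc f θ₀ (r m)) atTop (𝓝 0) := by
  refine tendsto_order.2 ⟨fun a ha => Eventually.of_forall fun m => ha.trans_le osc_nonneg,
    fun ε hε => ?_⟩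
  obtain ⟨δ, hδ, hfδ⟩ := Metric.continuousAt_iff.1 hf (ε / 2) (half_pos hε)
  filter_upwards [hr.eventually_lt_const hδ] with m hm
  refine (osc_le (half_pos hε).le fun θ hθ => ?_).trans_lt (half_lt_self hε)
  rw [← dist_eq_norm]
  exact (hfδ ((Metric.mem_closedBall.1 hθ).trans_lt hm)).le

variable [ProperSpace Θ]

theorem norm_sub_le_osc (hf : Continuous f) {θ : Θ} (hθ : θ ∈ Metric.closedBall θ₀ r) :
    ‖f θ - f θ₀‖ ≤ osc f θ₀ r :=
  le_csSup ((isCompact_closedBall θ₀ r).image (by fun_prop)).bddAbove (Set.mem_image_of_mem _ hθ)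

theorem continuous_osc {Y : Type*} [TopologicalSpace Y] {F : Y → Θ → V} (hF : Continuous ↿F)
    (θ₀ : Θ) (r : ℝ) : Continuous fun y => osc (F y) θ₀ r := by
  have hF₀ : Continuous fun y => F y θ₀ :=
    hF.comp (by fun_prop : Continuous fun y : Y => (y, θ₀))
  exact (isCompact_closedBall θ₀ r).continuous_sSup (f := fun y θ => ‖F y θ - F y θ₀‖)
    (hF.sub (hF₀.comp continuous_fst)).norm

end Oscillation

section UniformLaw

variable {Ω Y : Type*} [MeasurableSpace Ω] {P : Measure Ω} [MeasurableSpace Y] {z : ℕ → Ω → Y}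

theorem ae_tendsto_empMean {E : Type*} [NormedAddCommGroup E] [NormedSpace ℝ E] [CompleteSpace E]
    [MeasurableSpace E] [BorelSpace E] (hindep : iIndepFun z P)
    (hid : ∀ i, IdentDistrib (z i) (z 0) P P) {φ : Y → E} (hφ : Measurable φ)
    (hint : Integrable (fun ω => φ (z 0 ω)) P) :
    ∀ᵐ ω ∂P, Tendsto (empMean fun i => φ (z i ω)) atTop (𝓝 (∫ ω, φ (z 0 ω) ∂P)) :=
  strong_law_ae (fun i ω => φ (z i ω)) hint
    (fun _ _ hij => (hindep.indepFun hij).comp hφ hφ) fun i => (hid i).comp hφ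

variable [TopologicalSpace Y] [OpensMeasurableSpace Y]

theorem integrable_and_tendsto_integral_osc {Θ V : Type*} [PseudoMetricSpace Θ] [ProperSpace Θ]
    [SeminormedAddCommGroup V] {F : Y → Θ → V}
    (hF : Continuous ↿F) {θ₀ : Θ} {R : ℝ} {X : Ω → Y} (hX : AEMeasurable X P) {H : Y → ℝ}
    (hH : Integrable (fun ω => H (X ω)) P) (hdom : ∀ y, ∀ θ ∈ Metric.closedBall θ₀ R, ‖F y θ‖ ≤ H y)
    {r : ℕ → ℝ} (hr : ∀ m, r m ∈ Set.Ioo 0 R) (hr₀ : Tendsto r atTop (𝓝 0)) :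
    (∀ m, Integrable (fun ω => osc (F (X ω)) θ₀ (r m)) P) ∧
      Tendsto (fun m => ∫ ω, osc (F (X ω)) θ₀ (r m) ∂P) atTop (𝓝 0) := by
  have hθ₀ : θ₀ ∈ Metric.closedBall θ₀ R :=
    Metric.mem_closedBall_self ((hr 0).1.trans (hr 0).2).le
  have hbound : ∀ m y, ‖osc (F y) θ₀ (r m)‖ ≤ 2 * H y := fun m y => by
    rw [Real.norm_of_nonneg osc_nonneg]
    refine osc_le (by linarith [(norm_nonneg _).trans (hdom y θ₀ hθ₀)]) fun θ hθ => ?_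
    have hθR := hdom y θ (Metric.closedBall_subset_closedBall (hr m).2.le hθ)
    linarith [norm_sub_le (F y θ) (F y θ₀), hdom y θ₀ hθ₀]
  have hmeas : ∀ m, AEStronglyMeasurable (fun ω => osc (F (X ω)) θ₀ (r m)) P := fun m =>
    ((continuous_osc hF θ₀ (r m)).measurable.comp_aemeasurable hX).aestronglyMeasurable
  refine ⟨fun m => (hH.const_mul 2).mono' (hmeas m) (ae_of_all _ fun ω => hbound m _), ?_⟩
  have hlim : ∀ y, Tendsto (fun m => osc (F y) θ₀ (r m)) atTop (𝓝 0) := fun y =>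
    tendsto_osc (hF.comp (by fun_prop : Continuous fun θ : Θ => (y, θ))).continuousAt hr₀
  simpa using tendsto_integral_of_dominated_convergence (μ := P) (fun ω => 2 * H (X ω)) hmeas
    (hH.const_mul 2) (fun m => ae_of_all _ fun ω => hbound m _) (ae_of_all _ fun ω => hlim (X ω))

theorem ae_hasUnifStrictFDerivAt_empMean [TopologicalSpace.PseudoMetrizableSpace Y]
    [SecondCountableTopology Y] {Θ E : Type*} [NormedAddCommGroup Θ] [NormedSpace ℝ Θ]
    [ProperSpace Θ] [NormedAddCommGroup E] [NormedSpace ℝ E] [CompleteSpace E]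
    [MeasurableSpace E] [BorelSpace E]
    (hindep : iIndepFun z P) (hid : ∀ i, IdentDistrib (z i) (z 0) P P)
    {F : Y → Θ → E} {F' : Y → Θ → Θ →L[ℝ] E} {θ₀ : Θ} {R : ℝ} (hR : 0 < R)
    (hF : ∀ y θ, HasFDerivAt (F y) (F' y θ) θ) (hF' : Continuous ↿F')
    (hm : Measurable fun y => F y θ₀) (hint : Integrable (fun ω => F (z 0 ω) θ₀) P)
    {H : Y → ℝ} (hH : Integrable (fun ω => H (z 0 ω)) P)
    (hdom : ∀ y, ∀ θ ∈ Metric.closedBall θ₀ R, ‖F' y θ‖ ≤ H y) :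
    Integrable (fun ω => F' (z 0 ω) θ₀) P ∧ ∀ᵐ ω ∂P, HasUnifStrictFDerivAt atTop
      (fun n θ => empMean (fun i => F (z i ω) θ) n)
      (∫ ω, F (z 0 ω) θ₀ ∂P) (∫ ω, F' (z 0 ω) θ₀ ∂P) θ₀ := by
  have hX : AEMeasurable (z 0) P := (hid 0).aemeasurable_fst
  have hF'₀ : Continuous fun y => F' y θ₀ :=
    hF'.comp (by fun_prop : Continuous fun y : Y => (y, θ₀))
  have hF'int : Integrable (fun ω => F' (z 0 ω) θ₀) P :=
    hH.mono' (hF'₀.aestronglyMeasurable.comp_aemeasurable hX)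
      (ae_of_all _ fun ω => hdom _ _ (Metric.mem_closedBall_self hR.le))
  refine ⟨hF'int, ?_⟩
  obtain ⟨r, -, hr, hr₀⟩ := exists_seq_strictAnti_tendsto' hR
  obtain ⟨hoscint, hosc⟩ := integrable_and_tendsto_integral_osc hF' hX hH hdom hr hr₀
  have hoscmean : ∀ᵐ ω ∂P, ∀ m, Tendsto (empMean fun i => osc (F' (z i ω)) θ₀ (r m)) atTop
      (𝓝 (∫ ω, osc (F' (z 0 ω)) θ₀ (r m) ∂P)) := ae_all_iff.2 fun m =>
    ae_tendsto_empMean (φ := fun y => osc (F' y) θ₀ (r m)) hindep hid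
      (continuous_osc hF' θ₀ (r m)).measurable (hoscint m)
  have hF'mean := ae_tendsto_empMean hindep hid hF'₀.measurable hF'int
  filter_upwards [ae_tendsto_empMean hindep hid hm hint, hF'mean, hoscmean] with ω hFω hF'ω hoscω
  refine hasUnifStrictFDerivAt_empMean (fun i θ => hF (z i ω) θ) hFω hF'ω fun ε hε => ?_
  obtain ⟨m, hm⟩ := (hosc.eventually_lt_const hε).exists
  exact ⟨r m, (hr m).1, fun i => osc (F' (z i ω)) θ₀ (r m), fun i θ hθ => norm_sub_le_osc
    (hF'.comp (by fun_prop : Continuous fun θ : Θ => (z i ω, θ))) hθ,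
    (hoscω m).eventually_le_const hm⟩

end UniformLaw

section StochasticOrder

open scoped ENNReal

variable {Ω : Type*} [MeasurableSpace Ω] {P : Measure Ω} {E F : Type*} [NormedAddCommGroup E]
  [NormedAddCommGroup F]

/-- `b n = O_P(n^{-1/2})`, in the form of a tail bound on `√n ‖b n‖` that is uniform in `n`. -/
def IsRootBounded (P : Measure Ω) (b : ℕ → Ω → E) : Prop :=
  ∀ ε : ℝ≥0∞, ε ≠ 0 → ∃ M : ℝ, 0 < M ∧ ∀ n : ℕ, P {ω | M ≤ √n * ‖b n ω‖} ≤ ε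

theorem IsRootBounded.prodMk {b : ℕ → Ω → E} {c : ℕ → Ω → F} (hb : IsRootBounded P b)
    (hc : IsRootBounded P c) : IsRootBounded P fun n ω => (b n ω, c n ω) := by
  intro ε hε
  obtain ⟨M, hM, hbM⟩ := hb (ε / 2) (ENNReal.half_pos hε).ne'
  obtain ⟨N, -, hcN⟩ := hc (ε / 2) (ENNReal.half_pos hε).ne'
  refine ⟨max M N, lt_max_of_lt_left hM, fun n => ?_⟩
  calc P {ω | max M N ≤ √n * ‖(b n ω, c n ω)‖}
      ≤ P ({ω | M ≤ √n * ‖b n ω‖} ∪ {ω | N ≤ √n * ‖c n ω‖}) := by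
        refine measure_mono fun ω hω => ?_
        rw [Set.mem_ofPred_eq, Prod.norm_mk, mul_max_of_nonneg _ _ (Real.sqrt_nonneg _),
          le_max_iff] at hω
        exact hω.imp (le_max_left _ _).trans (le_max_right _ _).trans
    _ ≤ ε / 2 + ε / 2 := (measure_union_le _ _).trans (add_le_add (hbM n) (hcN n))
    _ = ε := ENNReal.add_halves ε

theorem IsRootBounded.pi {κ : Type*} [Fintype κ] {E : κ → Type*} [∀ k, NormedAddCommGroup (E k)]
    [∀ k, NormedSpace ℝ (E k)] {b : ℕ → Ω → ∀ k, E k}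
    (h : ∀ k, IsRootBounded P fun n ω => b n ω k) : IsRootBounded P b := by
  intro ε hε
  choose M hM hbM using fun k => h k (ε / (Fintype.card κ + 1))
    (ENNReal.div_pos hε (by finiteness)).ne'
  have hle : ∀ k, M k ≤ 1 + ∑ k, M k := fun k => by
    linarith [Finset.single_le_sum (fun k _ => (hM k).le) (Finset.mem_univ k)]
  have hpos : 0 < 1 + ∑ k, M k :=
    add_pos_of_pos_of_nonneg one_pos (Finset.sum_nonneg fun k _ => (hM k).le)
  refine ⟨1 + ∑ k, M k, hpos, fun n => ?_⟩
  calc P {ω | 1 + ∑ k, M k ≤ √n * ‖b n ω‖} ≤ P (⋃ k, {ω | M k ≤ √n * ‖b n ω k‖}) := by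
        refine measure_mono fun ω hω => ?_
        by_contra! hcon
        simp only [Set.mem_iUnion, Set.mem_ofPred_eq, not_exists, not_le] at hcon hω
        refine hω.not_gt ?_
        rw [← norm_smul_of_nonneg (Real.sqrt_nonneg _), pi_norm_lt_iff hpos]
        intro k
        rw [Pi.smul_apply, norm_smul_of_nonneg (Real.sqrt_nonneg _)]
        exact (hcon k).trans_le (hle k)
    _ ≤ ∑ k, ε / (Fintype.card κ + 1) :=
        (measure_iUnion_fintype_le _ _).trans (Finset.sum_le_sum fun k _ => hbM k n)
    _ ≤ ε := by
        rw [Finset.sum_const, Finset.card_univ, nsmul_eq_mul, ← mul_div_assoc, mul_comm,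
          mul_div_assoc]
        exact mul_le_of_le_one_right' (ENNReal.div_le_of_le_mul (by simp))

theorem isRootBounded_zero : IsRootBounded P fun _ _ => (0 : E) :=
  fun _ _ => ⟨1, one_pos, fun n => by simp [not_le.2 one_pos]⟩

theorem variance_sqrt_mul_empMean_le {X : ℕ → Ω → ℝ} (hX : ∀ i, MemLp (X i) 2 P)
    (hindep : Pairwise (Function.onFun (IndepFun · · P) X))
    (hvar : ∀ i, variance (X i) P = variance (X 0) P) (n : ℕ) :
    variance (fun ω => √n * empMean (fun i => X i ω) n) P ≤ variance (X 0) P := by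
  have heq : (fun ω => √n * empMean (fun i => X i ω) n) =
      fun ω => (√n * (n : ℝ)⁻¹) * (∑ i ∈ Finset.range n, X i) ω := by
    funext ω
    simp only [empMean, smul_eq_mul, Finset.sum_apply, mul_assoc]
  rw [heq, variance_const_mul, IndepFun.variance_sum (fun i _ => hX i)
    (fun i _ j _ hij => hindep hij), Finset.sum_congr rfl fun i _ => hvar i, Finset.sum_const,
    Finset.card_range, nsmul_eq_mul, mul_pow, Real.sq_sqrt n.cast_nonneg]
  rcases n.eq_zero_or_pos with rfl | hn
  · simp
  · have hn₀ : (n : ℝ) ≠ 0 := by positivity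
    exact le_of_eq (by field_simp)

theorem isRootBounded_empMean [IsProbabilityMeasure P] {X : ℕ → Ω → ℝ} (hX : MemLp (X 0) 2 P)
    (hmean : ∫ ω, X 0 ω ∂P = 0) (hindep : Pairwise (Function.onFun (IndepFun · · P) X))
    (hid : ∀ i, IdentDistrib (X i) (X 0) P P) :
    IsRootBounded P fun n ω => empMean (fun i => X i ω) n := by
  have hXi : ∀ i, MemLp (X i) 2 P := fun i => (hid i).memLp_iff.2 hX
  set V := variance (X 0) P
  intro ε hε
  have hlim : Tendsto (fun M : ℝ => ENNReal.ofReal (V / M ^ 2)) atTop (𝓝 0) := by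
    simpa using ENNReal.tendsto_ofReal
      (tendsto_const_nhds (x := V).div_atTop (tendsto_pow_atTop (α := ℝ) two_ne_zero))
  obtain ⟨M, hMε, hM⟩ := ((hlim.eventually_lt_const hε.bot_lt).and (eventually_gt_atTop 0)).exists
  refine ⟨M, hM, fun n => ?_⟩
  set S : Ω → ℝ := fun ω => √n * empMean (fun i => X i ω) n with hS
  have hSL2 : MemLp S 2 P :=
    ((memLp_finsetSum _ fun i _ => hXi i).const_mul _).const_mul _
  have hSmean : ∫ ω, S ω ∂P = 0 := by
    simp only [hS, empMean, smul_eq_mul, integral_const_mul]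
    rw [integral_finsetSum _ fun i _ => (hXi i).integrable one_le_two]
    simp [(hid _).integral_eq, hmean]
  calc P {ω | M ≤ √n * ‖empMean (fun i => X i ω) n‖} = P {ω | M ≤ |S ω - ∫ ω, S ω ∂P|} := by
        rw [hSmean]
        simp only [sub_zero, hS, abs_mul, abs_of_nonneg (Real.sqrt_nonneg _), Real.norm_eq_abs]
    _ ≤ ENNReal.ofReal (variance S P / M ^ 2) := meas_ge_le_variance_div_sq hSL2 hM
    _ ≤ ENNReal.ofReal (V / M ^ 2) := by
        gcongr
        exact variance_sqrt_mul_empMean_le hXi hindep (fun i => (hid i).variance_eq) n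
    _ ≤ ε := hMε.le

theorem IsLittleOP.mul_one_add_isRootBounded {Q : ℕ → Ω → ℝ} {b : ℕ → Ω → E}
    (hQ : IsLittleOP P Q) (hb : IsRootBounded P b) :
    IsLittleOP P fun n ω => Q n ω * (1 + √n * ‖b n ω‖) := by
  rw [IsLittleOP, tendstoInMeasure_iff_norm] at hQ ⊢
  intro ε hε
  rw [ENNReal.tendsto_nhds_zero]
  intro η hη
  obtain ⟨M, hM, hbM⟩ := hb (η / 2) (ENNReal.half_pos hη.ne').ne'
  filter_upwards [ENNReal.tendsto_nhds_zero.1 (hQ (ε / (1 + M)) (by positivity)) (η / 2)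
    (ENNReal.half_pos hη.ne')] with n hn
  calc P {ω | ε ≤ ‖Q n ω * (1 + √n * ‖b n ω‖) - 0‖}
      ≤ P ({ω | ε / (1 + M) ≤ ‖Q n ω - 0‖} ∪ {ω | M ≤ √n * ‖b n ω‖}) := by
        refine measure_mono fun ω hω => ?_
        by_contra! hcon
        simp only [Set.mem_union, Set.mem_ofPred_eq, not_or, not_le, sub_zero] at hcon hω
        obtain ⟨hQω, hbω⟩ := hcon
        rw [norm_mul, Real.norm_of_nonneg (by positivity : 0 ≤ 1 + √n * ‖b n ω‖)] at hω
        rw [lt_div_iff₀ (by positivity)] at hQω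
        have hle : ‖Q n ω‖ * (1 + √n * ‖b n ω‖) ≤ ‖Q n ω‖ * (1 + M) := by gcongr
        linarith
    _ ≤ η / 2 + η / 2 := (measure_union_le _ _).trans (add_le_add hn (hbM n))
    _ = η := ENNReal.add_halves η

theorem isLittleOP_sqrt_mul_of_ae_isLittleO [IsFiniteMeasure P] [MeasurableSpace E]
    [OpensMeasurableSpace E] {R : ℕ → Ω → ℝ} {b : ℕ → Ω → E} (hR : ∀ n, Measurable (R n))
    (hbm : ∀ n, Measurable (b n)) (hb : IsRootBounded P b)
    (h : ∀ᵐ ω ∂P, (fun n => R n ω) =o[atTop] fun n => b n ω) :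
    IsLittleOP P fun n ω => √n * R n ω := by
  have hpos : ∀ (n : ℕ) ω, 0 < 1 + √n * ‖b n ω‖ := fun n ω => by positivity
  have hratio : IsLittleOP P fun n ω => √n * R n ω / (1 + √n * ‖b n ω‖) := by
    refine tendstoInMeasure_of_tendsto_ae (fun n => (((hR n).const_mul _).div
      (((hbm n).norm.const_mul _).const_add _)).aestronglyMeasurable) ?_
    filter_upwards [h] with ω hω
    have hO : (fun n : ℕ => √n * ‖b n ω‖) =O[atTop] fun n => 1 + √n * ‖b n ω‖ :=
      IsBigO.of_norm_le fun n => by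
        rw [Real.norm_of_nonneg (by positivity)]
        linarith
    exact (((isBigO_refl (fun n : ℕ => √(n : ℝ)) atTop).mul_isLittleO
      hω.norm_right).trans_isBigO hO).tendsto_div_nhds_zero
  simpa only [div_mul_cancel₀ _ (hpos _ _).ne'] using hratio.mul_one_add_isRootBounded hb

end StochasticOrder

section CentredProjection

/-- Pairs `(u, m)` of a direction `u` and a centre `m`, the parameters of the sample averages.
Moving the centre along with the direction is what handles the unknown mean. -/
abbrev DirCentre (p : ℕ) : Type := (Fin p → ℝ) × (Fin p → ℝ)

variable {p : ℕ}

/-- The `j`-th coordinate axis through the origin, the parameter around which all averages are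
expanded. -/
def axis (j : Fin p) : DirCentre p := (Pi.single j 1, 0)

/-- The projection `uᵀ(y - m)` of an observation. -/
def centredProj (θ : DirCentre p) (y : Fin p → ℝ) : ℝ := θ.1 ⬝ᵥ (y - θ.2)

/-- The dot product as a continuous bilinear map for the supremum norm. -/
def dotL (p : ℕ) : (Fin p → ℝ) →L[ℝ] (Fin p → ℝ) →L[ℝ] ℝ :=
  (dotProductBilin ℝ ℝ).toContinuousBilinearMap

/-- The derivative of `centredProj` with respect to `(u, m)`. -/
def centredProjDeriv (θ : DirCentre p) (y : Fin p → ℝ) : DirCentre p →L[ℝ] ℝ :=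
  (dotL p (y - θ.2)).comp (ContinuousLinearMap.fst ℝ _ _) -
    (dotL p θ.1).comp (ContinuousLinearMap.snd ℝ _ _)

theorem dotL_apply (u v : Fin p → ℝ) : dotL p u v = u ⬝ᵥ v := rfl

theorem centredProj_axis (j : Fin p) (y : Fin p → ℝ) : centredProj (axis j) y = y j := by
  simp [centredProj, axis]

theorem centredProjDeriv_apply (θ h : DirCentre p) (y : Fin p → ℝ) :
    centredProjDeriv θ y h = (y - θ.2) ⬝ᵥ h.1 - θ.1 ⬝ᵥ h.2 := rfl

theorem continuous_centredProj :
    Continuous fun q : (Fin p → ℝ) × DirCentre p => centredProj q.2 q.1 := by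
  unfold centredProj
  fun_prop

theorem continuous_centredProjDeriv :
    Continuous fun q : (Fin p → ℝ) × DirCentre p => centredProjDeriv q.2 q.1 := by
  unfold centredProjDeriv
  fun_prop

theorem hasFDerivAt_centredProj (θ : DirCentre p) (y : Fin p → ℝ) :
    HasFDerivAt (fun θ => centredProj θ y) (centredProjDeriv θ y) θ := by
  have hu : HasFDerivAt (fun θ : DirCentre p => θ.1) (ContinuousLinearMap.fst ℝ _ _) θ :=
    hasFDerivAt_fst
  have hm : HasFDerivAt (fun θ : DirCentre p => y - θ.2) (-ContinuousLinearMap.snd ℝ _ _) θ :=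
    hasFDerivAt_snd.const_sub y
  refine ((dotL p).hasFDerivAt_of_bilinear hu hm).congr_fderiv ?_
  ext h <;> simp [centredProjDeriv, dotL_apply, dotProduct_comm]

theorem abs_dotProduct_le (u v : Fin p → ℝ) : |u ⬝ᵥ v| ≤ p * ‖u‖ * ‖v‖ :=
  calc |u ⬝ᵥ v| ≤ ∑ _k : Fin p, ‖u‖ * ‖v‖ := by
        rw [dotProduct, ← Real.norm_eq_abs]
        refine norm_sum_le_of_le _ fun k _ => ?_
        rw [norm_mul]
        exact mul_le_mul (norm_le_pi_norm u k) (norm_le_pi_norm v k) (norm_nonneg _) (norm_nonneg _)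
    _ = p * ‖u‖ * ‖v‖ := by simp [mul_assoc]

theorem norm_dotL_le (u : Fin p → ℝ) : ‖dotL p u‖ ≤ p * ‖u‖ :=
  ContinuousLinearMap.opNorm_le_bound _ (by positivity) (abs_dotProduct_le u)

theorem norm_centredProjDeriv_le (θ : DirCentre p) (y : Fin p → ℝ) :
    ‖centredProjDeriv θ y‖ ≤ p * (‖y - θ.2‖ + ‖θ.1‖) :=
  calc ‖centredProjDeriv θ y‖ ≤ ‖dotL p (y - θ.2)‖ * 1 + ‖dotL p θ.1‖ * 1 := by
        refine (norm_sub_le _ _).trans (add_le_add ?_ ?_) <;>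
          refine (ContinuousLinearMap.opNorm_comp_le _ _).trans ?_ <;> gcongr
        exacts [ContinuousLinearMap.norm_fst_le _ _ _, ContinuousLinearMap.norm_snd_le _ _ _]
    _ ≤ p * ‖y - θ.2‖ * 1 + p * ‖θ.1‖ * 1 := by gcongr <;> exact norm_dotL_le _
    _ = p * (‖y - θ.2‖ + ‖θ.1‖) := by ring

variable {j : Fin p} {θ : DirCentre p} {r : ℝ}

theorem norm_sub_le_of_mem_closedBall_axis (hr : r ≤ 1) (hθ : θ ∈ Metric.closedBall (axis j) r) :
    ‖θ.1 - Pi.single j 1‖ ≤ r ∧ ‖θ.2‖ ≤ r ∧ ∀ y, ‖y - θ.2‖ ≤ 1 + ‖y‖ := by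
  rw [Metric.mem_closedBall, dist_eq_norm, Prod.norm_def, max_le_iff] at hθ
  simp only [axis, Prod.fst_sub, Prod.snd_sub, sub_zero] at hθ
  exact ⟨hθ.1, hθ.2, fun y => (norm_sub_le _ _).trans (by linarith [hθ.2])⟩

theorem norm_centredProjDeriv_le_of_mem_closedBall_axis (hr : r ≤ 1)
    (hθ : θ ∈ Metric.closedBall (axis j) r) (y : Fin p → ℝ) :
    ‖centredProjDeriv θ y‖ ≤ 3 * p * (1 + ‖y‖) := by
  obtain ⟨hu, -, hm⟩ := norm_sub_le_of_mem_closedBall_axis hr hθ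
  have hsingle : ‖(Pi.single j 1 : Fin p → ℝ)‖ = 1 := by rw [Pi.norm_single, norm_one]
  have hu₂ : ‖θ.1‖ ≤ 2 := by linarith [norm_sub_norm_le θ.1 (Pi.single j 1)]
  calc ‖centredProjDeriv θ y‖ ≤ p * (‖y - θ.2‖ + ‖θ.1‖) := norm_centredProjDeriv_le θ y
    _ ≤ p * (3 * (1 + ‖y‖)) := by
        gcongr
        linarith [hm y, norm_nonneg y]
    _ = 3 * p * (1 + ‖y‖) := by ring

theorem abs_centredProj_sub_le (hr : r ≤ 1) (hθ : θ ∈ Metric.closedBall (axis j) r)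
    (y : Fin p → ℝ) : |centredProj θ y - y j| ≤ (p + 1) * r * (1 + ‖y‖) := by
  obtain ⟨hu, hm, hym⟩ := norm_sub_le_of_mem_closedBall_axis hr hθ
  have hr₀ : 0 ≤ r := (norm_nonneg _).trans hm
  have hsplit : centredProj θ y - y j = (θ.1 - Pi.single j 1) ⬝ᵥ (y - θ.2) - θ.2 j := by
    rw [sub_dotProduct, single_one_dotProduct, centredProj, Pi.sub_apply]
    ring
  calc |centredProj θ y - y j| ≤ |(θ.1 - Pi.single j 1) ⬝ᵥ (y - θ.2)| + |θ.2 j| :=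
        hsplit ▸ abs_sub _ _
    _ ≤ p * r * (1 + ‖y‖) + r * (1 + ‖y‖) := by
        refine add_le_add ((abs_dotProduct_le _ _).trans ?_)
          ((norm_le_pi_norm θ.2 j).trans (hm.trans ?_))
        · gcongr
          exact hym y
        · exact le_mul_of_one_le_right hr₀ (by linarith [norm_nonneg y])
    _ = (p + 1) * r * (1 + ‖y‖) := by ring

end CentredProjection

section Domination

theorem pi_norm_sq_le_sum_sq {κ : Type*} [Fintype κ] (y : κ → ℝ) : ‖y‖ ^ 2 ≤ ∑ k, y k ^ 2 := by
  have hsum : 0 ≤ ∑ k, y k ^ 2 := Finset.sum_nonneg fun k _ => sq_nonneg _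
  refine (Real.le_sqrt (norm_nonneg _) hsum).1 ((pi_norm_le_iff_of_nonneg (Real.sqrt_nonneg _)).2
    fun k => Real.abs_le_sqrt ?_)
  exact Finset.single_le_sum (f := fun k => y k ^ 2) (fun k _ => sq_nonneg _) (Finset.mem_univ k)

theorem abs_mul_one_add_le {f : ℝ → ℝ} (hf : Differentiable ℝ f) {s t a ε C : ℝ} (ha : 0 ≤ a)
    (hε : 0 ≤ ε) (hC : ∀ τ, |τ - s| ≤ ε * (1 + a) → |deriv f τ| * (1 + a ^ 2) ≤ C)
    (ht : |t - s| ≤ ε * (1 + a)) :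
    |f t| * (1 + a) ≤ 2 * (1 + a ^ 2) + f s ^ 2 + 2 * ε * C := by
  have hC₀ : 0 ≤ C := le_trans (by positivity) (hC t ht)
  have hsq : (1 + a) ^ 2 ≤ 2 * (1 + a ^ 2) := by linarith [sq_nonneg (1 - a)]
  have hmv : |f t - f s| ≤ C / (1 + a ^ 2) * |t - s| := by
    refine Convex.norm_image_sub_le_of_norm_deriv_le
      (s := Metric.closedBall s (ε * (1 + a))) (fun τ _ => hf τ) (fun τ hτ => ?_)
      (convex_closedBall _ _) (Metric.mem_closedBall_self (by positivity)) ht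
    exact (le_div_iff₀ (by positivity)).2 (hC τ hτ)
  have hincr : |f t - f s| * (1 + a) ≤ 2 * ε * C :=
    calc |f t - f s| * (1 + a) ≤ C / (1 + a ^ 2) * (ε * (1 + a)) * (1 + a) := by
          gcongr
          exact hmv.trans (by gcongr)
      _ = ε * C * ((1 + a) ^ 2 / (1 + a ^ 2)) := by ring
      _ ≤ ε * C * 2 := by
          gcongr
          rwa [div_le_iff₀ (by positivity)]
      _ = 2 * ε * C := by ring
  have hbase : |f s| * (1 + a) ≤ 2 * (1 + a ^ 2) + f s ^ 2 := by
    rw [← sq_abs (f s)]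
    nlinarith [sq_nonneg (|f s| - (1 + a)), sq_nonneg (1 + a), sq_nonneg |f s|]
  have htri : |f t| ≤ |f s| + |f t - f s| := by
    simpa using abs_add_le (f s) (f t - f s)
  calc |f t| * (1 + a) ≤ (|f s| + |f t - f s|) * (1 + a) := by gcongr
    _ = |f s| * (1 + a) + |f t - f s| * (1 + a) := add_mul _ _ _
    _ ≤ 2 * (1 + a ^ 2) + f s ^ 2 + 2 * ε * C := add_le_add hbase hincr

theorem contDiff_one_deriv {G : ℝ → ℝ} (hG : ContDiff ℝ 2 G) : ContDiff ℝ 1 (deriv G) :=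
  ContDiff.deriv' (n := 1) (by simpa [one_add_one_eq_two] using hG)

variable {Ω : Type*} [MeasurableSpace Ω] {P : Measure Ω} [IsFiniteMeasure P] {p : ℕ} {G : ℝ → ℝ}

theorem exists_dominating {y₀ : Ω → Fin p → ℝ} (hG : ContDiff ℝ 2 G) (hA2 : IsStandardized P y₀)
    (hA3 : HasMoments P G y₀) (hdom : IsLocallyDominated P G y₀) (j : Fin p) :
    ∃ r > 0, r ≤ 1 ∧ ∃ H : (Fin p → ℝ) → ℝ, Integrable (fun ω => H (y₀ ω)) P ∧
      ∀ y, ∀ θ ∈ Metric.closedBall (axis j) r,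
        |deriv (deriv G) (centredProj θ y)| * (1 + ‖y‖) ^ 2 ≤ H y ∧
        |deriv G (centredProj θ y)| * (1 + ‖y‖) ≤ H y := by
  obtain ⟨ε, hε, H, -, hHint, hH⟩ := hdom j
  set B : (Fin p → ℝ) → ℝ := fun y => 2 * (1 + ∑ k, y k ^ 2) + deriv G (y j) ^ 2 + 2 * ε * H y
  have hBint : Integrable (fun ω => B (y₀ ω)) P :=
    ((((integrable_const 1).add (integrable_finsetSum _ fun k _ =>
      (hA2 k).1.integrable_sq)).const_mul 2).add (hA3.sigma j)).add (hHint.const_mul (2 * ε))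
  refine ⟨min 1 (ε / (p + 1)), by positivity, min_le_left _ _, fun y => 2 * H y + B y,
    (hHint.const_mul 2).add hBint, fun y θ hθ => ?_⟩
  have ht : |centredProj θ y - y j| ≤ ε * (1 + ‖y‖) := by
    refine (abs_centredProj_sub_le (min_le_left _ _) hθ y).trans ?_
    gcongr
    calc ((p : ℝ) + 1) * min 1 (ε / (p + 1)) ≤ (p + 1) * (ε / (p + 1)) := by
          gcongr
          exact min_le_right _ _
      _ = ε := by field_simp
  have hg' := hH y _ ht
  have hg : |deriv G (centredProj θ y)| * (1 + ‖y‖) ≤ B y := by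
    refine (abs_mul_one_add_le ((contDiff_one_deriv hG).differentiable one_ne_zero)
      (norm_nonneg y) hε.le (hH y) ht).trans ?_
    simp only [B]
    gcongr
    exact pi_norm_sq_le_sum_sq y
  have hH₀ : 0 ≤ H y := le_trans (by positivity) hg'
  have hB₀ : 0 ≤ B y := le_trans (by positivity) hg
  refine ⟨?_, by linarith⟩
  calc |deriv (deriv G) (centredProj θ y)| * (1 + ‖y‖) ^ 2
      ≤ |deriv (deriv G) (centredProj θ y)| * (2 * (1 + ‖y‖ ^ 2)) := by
        gcongr
        linarith [sq_nonneg (1 - ‖y‖)]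
    _ ≤ 2 * H y + B y := by linarith

end Domination

section PopulationMoments

variable {Ω : Type*} [MeasurableSpace Ω] {P : Measure Ω} {p : ℕ} {y₀ : Ω → Fin p → ℝ}
  {φ : ℝ → ℝ} {j l : Fin p}

theorem integral_comp_mul_eq_zero (hm : Measurable y₀)
    (hind : iIndepFun (fun (j : Fin p) ω => y₀ ω j) P) (hA2 : IsStandardized P y₀)
    (hφ : Measurable φ) (hlj : l ≠ j) : ∫ ω, φ (y₀ ω j) * y₀ ω l ∂P = 0 := by
  have hmk : ∀ k, Measurable fun ω => y₀ ω k := measurable_pi_iff.1 hm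
  have h := ((hind.indepFun hlj.symm).comp hφ measurable_id).integral_fun_mul_eq_mul_integral
    (hφ.comp (hmk j)).aestronglyMeasurable (hmk l).aestronglyMeasurable
  exact h.trans (by simp [(hA2 l).2.1])

theorem integral_comp_mul_mul (hm : Measurable y₀)
    (hind : iIndepFun (fun (j : Fin p) ω => y₀ ω j) P) (hA2 : IsStandardized P y₀)
    (hφ : Measurable φ) (hlj : l ≠ j) (k : Fin p) :
    ∫ ω, φ (y₀ ω j) * y₀ ω k * y₀ ω l ∂P = if k = l then ∫ ω, φ (y₀ ω j) ∂P else 0 := by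
  have hmk : ∀ k, Measurable fun ω => y₀ ω k := measurable_pi_iff.1 hm
  split_ifs with hkl
  · subst hkl
    have hsq : Measurable fun t : ℝ => t * t := by fun_prop
    have h := ((hind.indepFun hlj.symm).comp hφ hsq).integral_fun_mul_eq_mul_integral
      (hφ.comp (hmk j)).aestronglyMeasurable (hsq.comp (hmk k)).aestronglyMeasurable
    simp only [Function.comp_apply, ← mul_assoc] at h
    simp only [h, ← pow_two, (hA2 k).2.2, mul_one]
  · have hmul : Measurable fun t : ℝ × ℝ => φ t.1 * t.2 := by fun_prop
    have h := ((hind.indepFun_prodMk hmk j k l hlj.symm hkl).comp hmul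
      measurable_id).integral_fun_mul_eq_mul_integral
      (hmul.comp ((hmk j).prodMk (hmk k))).aestronglyMeasurable (hmk l).aestronglyMeasurable
    exact h.trans (by simp [(hA2 l).2.1])

theorem integral_comp_mul_mul_dotProduct (hm : Measurable y₀)
    (hind : iIndepFun (fun (j : Fin p) ω => y₀ ω j) P) (hA2 : IsStandardized P y₀)
    (hφ : Measurable φ) (hlj : l ≠ j)
    (hint : ∀ k, Integrable (fun ω => φ (y₀ ω j) * y₀ ω k * y₀ ω l) P) (u : Fin p → ℝ) :
    Integrable (fun ω => φ (y₀ ω j) * y₀ ω l * (y₀ ω ⬝ᵥ u)) P ∧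
      ∫ ω, φ (y₀ ω j) * y₀ ω l * (y₀ ω ⬝ᵥ u) ∂P = (∫ ω, φ (y₀ ω j) ∂P) * u l := by
  have hexpand : (fun ω => φ (y₀ ω j) * y₀ ω l * (y₀ ω ⬝ᵥ u)) =
      fun ω => ∑ k, φ (y₀ ω j) * y₀ ω k * y₀ ω l * u k := by
    funext ω
    rw [dotProduct, Finset.mul_sum]
    exact Finset.sum_congr rfl fun k _ => by ring
  rw [hexpand]
  refine ⟨integrable_finsetSum _ fun k _ => (hint k).mul_const _, ?_⟩
  rw [integral_finsetSum _ fun k _ => (hint k).mul_const _]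
  simp only [integral_mul_const, integral_comp_mul_mul hm hind hA2 hφ hlj, ite_mul, zero_mul,
    Finset.sum_ite_eq', Finset.mem_univ, if_true]

end PopulationMoments

section ScoreTerm

variable {p : ℕ} {G : ℝ → ℝ}

/-- The `l`-th coordinate of `g(uᵀ(y - m)) (y - m)`, the contribution of one observation `y` to
`hatT`. -/
def scoreTerm (G : ℝ → ℝ) (l : Fin p) (y : Fin p → ℝ) (θ : DirCentre p) : ℝ :=
  deriv G (centredProj θ y) * (y l - θ.2 l)

/-- The `l`-th coordinate of the centre. -/
def centreCoord (l : Fin p) : DirCentre p →L[ℝ] ℝ :=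
  (ContinuousLinearMap.proj l).comp (ContinuousLinearMap.snd ℝ (Fin p → ℝ) (Fin p → ℝ))

/-- The derivative of `scoreTerm` with respect to `(u, m)`. -/
def scoreTermDeriv (G : ℝ → ℝ) (l : Fin p) (y : Fin p → ℝ) (θ : DirCentre p) :
    DirCentre p →L[ℝ] ℝ :=
  (deriv (deriv G) (centredProj θ y) * (y l - θ.2 l)) • centredProjDeriv θ y -
    deriv G (centredProj θ y) • centreCoord l

theorem norm_centreCoord_le (l : Fin p) : ‖centreCoord l‖ ≤ 1 :=
  ContinuousLinearMap.opNorm_le_bound _ zero_le_one fun h => by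
    rw [one_mul]
    exact (norm_le_pi_norm h.2 l).trans (norm_snd_le h)

theorem scoreTerm_axis (j l : Fin p) (y : Fin p → ℝ) :
    scoreTerm G l y (axis j) = deriv G (y j) * y l := by
  rw [scoreTerm, centredProj_axis]
  simp [axis]

theorem scoreTermDeriv_axis_apply (j l : Fin p) (y : Fin p → ℝ) (h : DirCentre p) :
    scoreTermDeriv G l y (axis j) h = deriv (deriv G) (y j) * y l * (y ⬝ᵥ h.1) -
      deriv (deriv G) (y j) * y l * h.2 j - deriv G (y j) * h.2 l := by
  rw [scoreTermDeriv, centredProj_axis]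
  simp only [centreCoord, _root_.sub_apply, _root_.smul_apply, centredProjDeriv_apply, axis,
    ContinuousLinearMap.comp_apply, ContinuousLinearMap.proj_apply, ContinuousLinearMap.coe_snd',
    single_one_dotProduct, Pi.zero_apply, sub_zero, smul_eq_mul, mul_sub]

theorem hasFDerivAt_scoreTerm (hG : ContDiff ℝ 2 G) (l : Fin p) (y : Fin p → ℝ)
    (θ : DirCentre p) : HasFDerivAt (scoreTerm G l y) (scoreTermDeriv G l y θ) θ := by
  have hg := (((contDiff_one_deriv hG).differentiable one_ne_zero _).hasDerivAt
    |>.comp_hasFDerivAt θ (hasFDerivAt_centredProj θ y))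
  refine (hg.mul ((centreCoord l).hasFDerivAt.const_sub (y l))).congr_fderiv ?_
  ext h <;> simp [scoreTermDeriv, centreCoord] <;> ring

theorem continuous_scoreTermDeriv (hG : ContDiff ℝ 2 G) (l : Fin p) :
    Continuous fun q : (Fin p → ℝ) × DirCentre p => scoreTermDeriv G l q.1 q.2 := by
  have hg := contDiff_one_deriv hG
  exact (((hg.continuous_deriv_one.comp continuous_centredProj).mul (by fun_prop)).smul
    continuous_centredProjDeriv).sub
    ((hg.continuous.comp continuous_centredProj).smul continuous_const)

theorem norm_scoreTermDeriv_le {j : Fin p} {r C : ℝ} (hr : r ≤ 1) {θ : DirCentre p}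
    (hθ : θ ∈ Metric.closedBall (axis j) r) {y : Fin p → ℝ}
    (h₂ : |deriv (deriv G) (centredProj θ y)| * (1 + ‖y‖) ^ 2 ≤ C)
    (h₁ : |deriv G (centredProj θ y)| * (1 + ‖y‖) ≤ C) (l : Fin p) :
    ‖scoreTermDeriv G l y θ‖ ≤ (3 * p + 1) * C := by
  have hyl : |y l - θ.2 l| ≤ 1 + ‖y‖ := (norm_le_pi_norm (y - θ.2) l).trans
    ((norm_sub_le_of_mem_closedBall_axis hr hθ).2.2 y)
  have hD := norm_centredProjDeriv_le_of_mem_closedBall_axis hr hθ y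
  have hg : |deriv G (centredProj θ y)| ≤ C :=
    (le_mul_of_one_le_right (abs_nonneg _) (by linarith [norm_nonneg y])).trans h₁
  calc ‖scoreTermDeriv G l y θ‖
      ≤ |deriv (deriv G) (centredProj θ y)| * |y l - θ.2 l| * ‖centredProjDeriv θ y‖ +
        |deriv G (centredProj θ y)| * ‖centreCoord l‖ := by
        refine (norm_sub_le _ _).trans_eq ?_
        simp only [norm_smul, Real.norm_eq_abs, abs_mul]
    _ ≤ |deriv (deriv G) (centredProj θ y)| * (1 + ‖y‖) * (3 * p * (1 + ‖y‖)) +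
        |deriv G (centredProj θ y)| * 1 := by
        gcongr
        exact norm_centreCoord_le l
    _ = 3 * p * (|deriv (deriv G) (centredProj θ y)| * (1 + ‖y‖) ^ 2) +
        |deriv G (centredProj θ y)| := by ring
    _ ≤ 3 * p * C + C := by gcongr
    _ = (3 * p + 1) * C := by ring

variable {Ω : Type*} [MeasurableSpace Ω] {P : Measure Ω} {y₀ : Ω → Fin p → ℝ}

theorem integral_scoreTerm_axis (hG : ContDiff ℝ 2 G) (hm : Measurable y₀)
    (hind : iIndepFun (fun (j : Fin p) ω => y₀ ω j) P) (hA2 : IsStandardized P y₀)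
    (j l : Fin p) :
    ∫ ω, scoreTerm G l (y₀ ω) (axis j) ∂P = if l = j then lam P G y₀ j else 0 := by
  simp only [scoreTerm_axis]
  split_ifs with hlj
  · rw [hlj, lam]
  · exact integral_comp_mul_eq_zero hm hind hA2 (contDiff_one_deriv hG).continuous.measurable hlj

theorem integral_scoreTermDeriv_axis_apply (hm : Measurable y₀)
    (hind : iIndepFun (fun (j : Fin p) ω => y₀ ω j) P) (hA2 : IsStandardized P y₀)
    (hA3 : HasMoments P G y₀) {H : (Fin p → ℝ) → ℝ} (hH : Integrable (fun ω => H (y₀ ω)) P)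
    {j l : Fin p} (hlj : l ≠ j)
    (hle : ∀ y : Fin p → ℝ, |deriv (deriv G) (y j)| * (1 + ‖y‖) ^ 2 ≤ H y) (h : DirCentre p) :
    ∫ ω, scoreTermDeriv G l (y₀ ω) (axis j) h ∂P =
      del P G y₀ j * h.1 l - mu P G y₀ j * h.2 l := by
  have hg' : Measurable (deriv (deriv G)) := measurable_deriv _
  have hmk : ∀ k, Measurable fun ω => y₀ ω k := measurable_pi_iff.1 hm
  have hbound : ∀ (y : Fin p → ℝ) (t : ℝ), |t| ≤ (1 + ‖y‖) ^ 2 →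
      |deriv (deriv G) (y j) * t| ≤ H y := fun y t ht => by
    rw [abs_mul]
    exact (mul_le_mul_of_nonneg_left ht (abs_nonneg _)).trans (hle y)
  have habs : ∀ (y : Fin p → ℝ) k, |y k| ≤ 1 + ‖y‖ := fun y k =>
    (norm_le_pi_norm y k).trans (by linarith)
  have hint₁ : Integrable (fun ω => deriv (deriv G) (y₀ ω j) * y₀ ω l) P :=
    hH.mono' ((hg'.comp (hmk j)).mul (hmk l)).aestronglyMeasurable <| ae_of_all _ fun ω =>
      hbound _ _ ((habs _ l).trans (le_self_pow₀ (by linarith [norm_nonneg (y₀ ω)]) two_ne_zero))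
  have hint₂ : ∀ k, Integrable (fun ω => deriv (deriv G) (y₀ ω j) * y₀ ω k * y₀ ω l) P := by
    refine fun k => hH.mono' (((hg'.comp (hmk j)).mul (hmk k)).mul (hmk l)).aestronglyMeasurable
      (ae_of_all _ fun ω => ?_)
    rw [mul_assoc]
    refine hbound _ _ ?_
    rw [abs_mul, sq]
    exact mul_le_mul (habs _ k) (habs _ l) (abs_nonneg _) (by positivity)
  obtain ⟨hint, heval⟩ := integral_comp_mul_mul_dotProduct hm hind hA2 hg' hlj hint₂ h.1
  simp only [scoreTermDeriv_axis_apply]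
  rw [integral_sub (by exact hint.sub (hint₁.mul_const _)) ((hA3.mu j).mul_const _),
    integral_sub hint (hint₁.mul_const _), heval, integral_mul_const, integral_mul_const,
    integral_comp_mul_eq_zero hm hind hA2 hg' hlj, zero_mul, sub_zero, del, mu]

end ScoreTerm

section UniformLawsOfEstimatingFunctions

/-- The sample average of `G(uᵀ(y - m))` as a function of `(u, m)`. -/
def avgG {p : ℕ} (G : ℝ → ℝ) (y : ℕ → Fin p → ℝ) (n : ℕ) (θ : DirCentre p) : ℝ :=
  empMean (fun i => G (centredProj θ (y i))) n

/-- The `l`-th coordinate of the sample average of `g(uᵀ(y - m)) (y - m)` as a function of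
`(u, m)`. -/
def avgT {p : ℕ} (G : ℝ → ℝ) (y : ℕ → Fin p → ℝ) (l : Fin p) (n : ℕ) (θ : DirCentre p) : ℝ :=
  empMean (fun i => scoreTerm G l (y i) θ) n

variable {Ω : Type*} [MeasurableSpace Ω] {P : Measure Ω} [IsFiniteMeasure P] {p : ℕ}
  {G : ℝ → ℝ} {loc : Fin p → ℝ} {A : Matrix (Fin p) (Fin p) ℝ} {x z : ℕ → Ω → Fin p → ℝ}

theorem ae_hasUnifStrictFDerivAt_avgG (hG : ContDiff ℝ 2 G) (hmodel : IsICSample P loc A x z)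
    (hA2 : IsStandardized P (z 0)) (hA3 : HasMoments P G (z 0))
    (hdom : IsLocallyDominated P G (z 0)) (j : Fin p) :
    ∃ L : DirCentre p →L[ℝ] ℝ, ∀ᵐ ω ∂P,
      HasUnifStrictFDerivAt atTop (avgG G fun i => z i ω) (nu P G (z 0) j) L (axis j) := by
  obtain ⟨r, hr, hr₁, H, hHint, hH⟩ := exists_dominating hG hA2 hA3 hdom j
  have hlaw := ae_hasUnifStrictFDerivAt_empMean (θ₀ := axis j) (H := fun y => 3 * p * H y)
    (F := fun y θ => G (centredProj θ y))
    (F' := fun y θ => deriv G (centredProj θ y) • centredProjDeriv θ y)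
    hmodel.indep_sample hmodel.identDistrib hr
    (fun y θ => (hG.differentiable two_ne_zero _).hasDerivAt.comp_hasFDerivAt θ
      (hasFDerivAt_centredProj θ y))
    (((contDiff_one_deriv hG).continuous.comp continuous_centredProj).smul
      continuous_centredProjDeriv)
    ?_ ?_ (hHint.const_mul _) ?_
  · refine ⟨_, hlaw.2.mono fun ω hω => hω.congr_deriv ?_ fun _ => rfl⟩
    simp only [nu, centredProj_axis]
  · simp only [centredProj_axis]
    exact hG.continuous.measurable.comp (measurable_pi_apply j)
  · simpa only [centredProj_axis] using hA3.nu j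
  · intro y θ hθ
    rw [norm_smul, Real.norm_eq_abs]
    calc |deriv G (centredProj θ y)| * ‖centredProjDeriv θ y‖
        ≤ |deriv G (centredProj θ y)| * (3 * p * (1 + ‖y‖)) := by
          gcongr
          exact norm_centredProjDeriv_le_of_mem_closedBall_axis hr₁ hθ y
      _ = 3 * p * (|deriv G (centredProj θ y)| * (1 + ‖y‖)) := by ring
      _ ≤ 3 * p * H y := by
          gcongr
          exact (hH y θ hθ).2

theorem ae_hasUnifStrictFDerivAt_avgT (hG : ContDiff ℝ 2 G) (hmodel : IsICSample P loc A x z)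
    (hA2 : IsStandardized P (z 0)) (hA3 : HasMoments P G (z 0))
    (hdom : IsLocallyDominated P G (z 0)) (j l : Fin p) :
    ∃ L : DirCentre p →L[ℝ] ℝ,
      (l ≠ j → ∀ h, L h = del P G (z 0) j * h.1 l - mu P G (z 0) j * h.2 l) ∧
      ∀ᵐ ω ∂P, HasUnifStrictFDerivAt atTop (avgT G (fun i => z i ω) l)
        (if l = j then lam P G (z 0) j else 0) L (axis j) := by
  obtain ⟨r, hr, hr₁, H, hHint, hH⟩ := exists_dominating hG hA2 hA3 hdom j
  have hm := hmodel.measurable 0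
  have hind := hmodel.indep_components
  have hHaxis : ∀ y : Fin p → ℝ, |deriv (deriv G) (y j)| * (1 + ‖y‖) ^ 2 ≤ H y ∧
      |deriv G (y j)| * (1 + ‖y‖) ≤ H y := fun y => by
    simpa only [centredProj_axis] using hH y _ (Metric.mem_closedBall_self hr.le)
  have hmeas : Measurable fun y : Fin p → ℝ => scoreTerm G l y (axis j) := by
    simp only [scoreTerm_axis]
    exact ((measurable_deriv G).comp (measurable_pi_apply j)).mul (measurable_pi_apply l)
  have hint : Integrable (fun ω => scoreTerm G l (z 0 ω) (axis j)) P := by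
    refine hHint.mono' (hmeas.comp hm).aestronglyMeasurable (ae_of_all _ fun ω => ?_)
    rw [scoreTerm_axis, norm_mul]
    refine le_trans ?_ (hHaxis (z 0 ω)).2
    exact mul_le_mul_of_nonneg_left
      ((norm_le_pi_norm (z 0 ω) l).trans (by linarith)) (norm_nonneg _)
  obtain ⟨hint', hlaw⟩ := ae_hasUnifStrictFDerivAt_empMean (θ₀ := axis j)
    (H := fun y => (3 * p + 1) * H y) hmodel.indep_sample hmodel.identDistrib hr
    (hasFDerivAt_scoreTerm hG l) (continuous_scoreTermDeriv hG l) hmeas hint (hHint.const_mul _)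
    fun y θ hθ => norm_scoreTermDeriv_le hr₁ hθ (hH y θ hθ).1 (hH y θ hθ).2 l
  refine ⟨_, fun hlj h => ?_, hlaw.mono fun ω hω =>
    hω.congr_deriv (integral_scoreTerm_axis hG hm hind hA2 j l) fun _ => rfl⟩
  rw [ContinuousLinearMap.integral_apply hint']
  exact integral_scoreTermDeriv_axis_apply hm hind hA2 hA3 hHint hlj (fun y => (hHaxis y).1) h

end UniformLawsOfEstimatingFunctions

section SampleStatistics

variable {p : ℕ} {G : ℝ → ℝ} {m lm d : Fin p → ℝ} {y : ℕ → Fin p → ℝ}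
  {X : ∀ n : ℕ, Fin n → Fin p → ℝ}

/-- `X n` is the sample `y 0, …, y (n - 1)` up to a translation. -/
def IsTranslate (y : ℕ → Fin p → ℝ) (X : ∀ n : ℕ, Fin n → Fin p → ℝ) : Prop :=
  ∀ n (i : Fin n), X n i - sampleMean (X n) = y i - empMean y n

theorem IsTranslate.hatG_eq (hX : IsTranslate y X) (n : ℕ) (γ : Fin p → ℝ) :
    hatG G (X n) γ = avgG G y n (γ, empMean y n) := by
  rw [avgG, empMean_eq_smul_sum_fin]
  simp only [hatG, hX n, smul_eq_mul, centredProj]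

theorem IsTranslate.hatT_apply (hX : IsTranslate y X) (n : ℕ) (γ : Fin p → ℝ) (l : Fin p) :
    hatT G (X n) γ l = avgT G y l n (γ, empMean y n) := by
  rw [avgT, empMean_eq_smul_sum_fin]
  simp only [hatT, hX n, scoreTerm, centredProj, Pi.smul_apply, Finset.sum_apply, smul_eq_mul,
    Pi.sub_apply]

theorem IsTranslate.sampleCov_apply (hX : IsTranslate y X) (n : ℕ) (k l : Fin p) :
    sampleCov (X n) k l =
      empMean (fun i => y i k * y i l) n - empMean y n k * empMean y n l := by
  have hcentre : ∀ (i : Fin n) k, X n i k - sampleMean (X n) k = y i k - empMean y n k :=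
    fun i k => congr_fun (hX n i) k
  rcases n.eq_zero_or_pos with rfl | hn
  · simp [sampleCov, empMean]
  have hn₀ : (n : ℝ) ≠ 0 := by positivity
  have hsum : ∀ k, ∑ i : Fin n, y i k = n * empMean y n k := fun k => by
    rw [empMean_apply, empMean_eq_smul_sum_fin, smul_eq_mul, mul_inv_cancel_left₀ hn₀]
  have hexpand : ∀ i : ℕ, (y i k - empMean y n k) * (y i l - empMean y n l) =
      y i k * y i l - y i k * empMean y n l - empMean y n k * y i l +
        empMean y n k * empMean y n l := fun i => by ring
  simp only [sampleCov, Matrix.of_apply, hcentre, hexpand, Finset.sum_add_distrib,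
    Finset.sum_sub_distrib, ← Finset.sum_mul, ← Finset.mul_sum, hsum, Finset.sum_const,
    Finset.card_univ, Fintype.card_fin, nsmul_eq_mul,
    empMean_eq_smul_sum_fin (fun i => y i k * y i l), smul_eq_mul]
  field_simp
  ring

theorem srcT_apply (a : ℝ) (y : ℕ → Fin p → ℝ) (n : ℕ) (j l : Fin p) :
    srcT G a (fun i : Fin n => y i) j l =
      empMean (fun i => (deriv G (y i j) - a) * y i l) n := by
  rw [empMean_eq_smul_sum_fin]
  simp only [srcT, Pi.smul_apply, Finset.sum_apply, smul_eq_mul]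

theorem srcT_eq_avgT_sub (a : ℝ) (y : ℕ → Fin p → ℝ) (n : ℕ) (j l : Fin p) :
    srcT G a (fun i : Fin n => y i) j l = avgT G y l n (axis j) - a * empMean y n l := by
  have hconst : a * empMean y n l = empMean (fun i => a * y i l) n := by
    rw [empMean_apply]
    exact map_empMean (LinearMap.mulLeft ℝ a) _ n
  rw [srcT_apply, avgT, hconst, ← empMean_sub]
  simp only [scoreTerm_axis, sub_mul]

/-- The centred quantities whose sample averages drive the expansions; the mean of `fluctTerm` over
the sample is the reference magnitude for all error terms.  The diagonal of the last component is
set to `0` because `g(z_j) z_j` need not be square integrable. -/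
def fluctTerm (G : ℝ → ℝ) (m : Fin p → ℝ) (y : Fin p → ℝ) :
    (Fin p → ℝ) × (Fin p → Fin p → ℝ) × (Fin p → Fin p → ℝ) :=
  (y, fun j l => y j * y l - if j = l then 1 else 0,
    fun j l => if l = j then 0 else (deriv G (y j) - m j) * y l)

/-- The sample average of `fluctTerm`, of order `n^{-1/2}` in probability. -/
def fluctuation (G : ℝ → ℝ) (m : Fin p → ℝ) (y : ℕ → Fin p → ℝ) (n : ℕ) :
    (Fin p → ℝ) × (Fin p → Fin p → ℝ) × (Fin p → Fin p → ℝ) :=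
  empMean (fun i => fluctTerm G m (y i)) n

/-- The coordinate functional `Γ ↦ Γ j l`. -/
def entry (j l : Fin p) : (Fin p → Fin p → ℝ) →L[ℝ] ℝ :=
  (ContinuousLinearMap.proj (R := ℝ) (φ := fun _ : Fin p => ℝ) l).comp
    (ContinuousLinearMap.proj (R := ℝ) (φ := fun _ : Fin p => Fin p → ℝ) j)

theorem entry_apply (j l : Fin p) (Γ : Fin p → Fin p → ℝ) : entry j l Γ = Γ j l := rfl

theorem isBigO_empMean_fluctuation (G : ℝ → ℝ) (m : Fin p → ℝ) (y : ℕ → Fin p → ℝ) :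
    empMean y =O[atTop] fluctuation G m y :=
  isBigO_empMean_comp (.fst ℝ _ _) fun i => fluctTerm G m (y i)

theorem isBigO_empMean_mul_fluctuation (G : ℝ → ℝ) (m : Fin p → ℝ) (y : ℕ → Fin p → ℝ)
    (j l : Fin p) :
    (empMean fun i => y i j * y i l - if j = l then 1 else 0) =O[atTop] fluctuation G m y :=
  isBigO_empMean_comp ((entry j l).comp ((ContinuousLinearMap.fst ℝ _ (Fin p → Fin p → ℝ)).comp
    (.snd ℝ (Fin p → ℝ) _))) fun i => fluctTerm G m (y i)

theorem isBigO_srcT_fluctuation (G : ℝ → ℝ) (m : Fin p → ℝ) (y : ℕ → Fin p → ℝ) {j l : Fin p}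
    (hlj : l ≠ j) :
    (fun n => srcT G (m j) (fun i : Fin n => y i) j l) =O[atTop] fluctuation G m y := by
  refine (isBigO_empMean_comp ((entry j l).comp
    ((ContinuousLinearMap.snd ℝ _ _).comp (.snd ℝ _ _)))
    fun i => fluctTerm G m (y i)).congr_left fun n => ?_
  simp [srcT_apply, entry_apply, fluctTerm, hlj]

/-- The limit theorems, for one realization `y` of the sources, on which the asymptotics of the
estimators rest; `m`, `lm` and `d` stand for the population values `μ`, `λ` and `δ`. -/
structure IsRegularSequence (G : ℝ → ℝ) (m lm d : Fin p → ℝ) (y : ℕ → Fin p → ℝ) : Prop where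
  mean : Tendsto (empMean y) atTop (𝓝 0)
  second : ∀ k l, Tendsto (empMean fun i => y i k * y i l) atTop (𝓝 (if k = l then 1 else 0))
  avgT : ∀ j l, ∃ L : DirCentre p →L[ℝ] ℝ, (l ≠ j → ∀ h, L h = d j * h.1 l - m j * h.2 l) ∧
    HasUnifStrictFDerivAt atTop (avgT G y l) (if l = j then lm j else 0) L (axis j)

theorem IsRegularSequence.tendsto_sampleCov (hy : IsRegularSequence G m lm d y)
    (hX : IsTranslate y X) (k l : Fin p) :
    Tendsto (fun n => sampleCov (X n) k l) atTop (𝓝 (if k = l then 1 else 0)) := by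
  have hm := tendsto_pi_nhds.1 hy.mean
  simpa [hX.sampleCov_apply] using (hy.second k l).sub ((hm k).mul (hm l))

theorem IsRegularSequence.isBigO_sampleCov_sub (hy : IsRegularSequence G m lm d y)
    (hX : IsTranslate y X) (k l : Fin p) :
    (fun n => sampleCov (X n) k l - if k = l then 1 else 0) =O[atTop] fluctuation G m y := by
  have hprod : (fun n => empMean y n k * empMean y n l) =O[atTop] fluctuation G m y := by
    simpa using ((tendsto_pi_nhds.1 hy.mean k).isBigO_one ℝ).mul
      (isBigO_pi.1 (isBigO_empMean_fluctuation G m y) l).norm_right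
  refine ((isBigO_empMean_mul_fluctuation G m y k l).sub hprod).congr' ?_ EventuallyEq.rfl
  filter_upwards [eventually_ne_atTop 0] with n hn
  rw [hX.sampleCov_apply, empMean_sub, empMean_const _ hn]
  ring

theorem IsRegularSequence.isLittleO_hatT_sub_srcT (hy : IsRegularSequence G m lm d y)
    (hX : IsTranslate y X) {j l : Fin p} (hlj : l ≠ j) :
    (fun n => hatT G (X n) (Pi.single j 1) l - srcT G (m j) (fun i : Fin n => y i) j l)
      =o[atTop] fluctuation G m y := by
  obtain ⟨L, hL, hT⟩ := hy.avgT j l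
  have hlin := hT.isLittleO_comp (u := fun n => (Pi.single j 1, empMean y n))
    (v := fun _ => axis j) (tendsto_const_nhds.prodMk_nhds hy.mean) tendsto_const_nhds
  have hstep : (fun n => ((Pi.single j 1, empMean y n) : DirCentre p) - axis j)
      =O[atTop] fluctuation G m y := by
    simp only [axis, Prod.mk_sub_mk, sub_self, sub_zero]
    exact (isBigO_zero _ _).prod_left (isBigO_empMean_fluctuation G m y)
  refine (hlin.trans_isBigO hstep).congr_left fun n => ?_
  rw [hL hlj, hX.hatT_apply, srcT_eq_avgT_sub]
  simp [axis]
  ring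

theorem IsRegularSequence.isBigO_hatT (hy : IsRegularSequence G m lm d y) (hX : IsTranslate y X)
    {j l : Fin p} (hlj : l ≠ j) :
    (fun n => hatT G (X n) (Pi.single j 1) l) =O[atTop] fluctuation G m y := by
  simpa using (hy.isLittleO_hatT_sub_srcT hX hlj).isBigO.add (isBigO_srcT_fluctuation G m y hlj)

end SampleStatistics

section SampleContinuity

variable {p n : ℕ} {G : ℝ → ℝ}

theorem continuous_sampleCov (j l : Fin p) :
    Continuous fun X : Fin n → Fin p → ℝ => sampleCov X j l := by
  simp only [sampleCov, Matrix.of_apply, sampleMean]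
  fun_prop

theorem continuous_hatT (hg : Continuous (deriv G)) (l : Fin p) :
    Continuous fun q : (Fin n → Fin p → ℝ) × (Fin p → ℝ) => hatT G q.1 q.2 l := by
  simp only [hatT, Pi.smul_apply, Finset.sum_apply, Pi.sub_apply, sampleMean, smul_eq_mul,
    dotProduct]
  fun_prop

theorem continuous_hatG (hG : Continuous G) :
    Continuous fun q : (Fin n → Fin p → ℝ) × (Fin p → ℝ) => hatG G q.1 q.2 := by
  simp only [hatG, Pi.sub_apply, sampleMean, dotProduct]
  fun_prop

theorem continuous_srcT (hg : Continuous (deriv G)) (a : ℝ) (j l : Fin p) :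
    Continuous fun Z : Fin n → Fin p → ℝ => srcT G a Z j l := by
  simp only [srcT, Pi.smul_apply, Finset.sum_apply, smul_eq_mul]
  fun_prop

theorem continuous_srcT2 (hG : Continuous G) (hg : Continuous (deriv G)) (a : ℝ) (j l : Fin p) :
    Continuous fun Z : Fin n → Fin p → ℝ => srcT2 G a Z j l := by
  simp only [srcT2, Pi.smul_apply, smul_eq_mul]
  exact (by fun_prop : Continuous fun Z : Fin n → Fin p → ℝ => (n : ℝ)⁻¹ * ∑ i, G (Z i j)).mul
    (continuous_srcT hg a j l)

theorem sampleCov_comm (X : Fin n → Fin p → ℝ) (j l : Fin p) :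
    sampleCov X j l = sampleCov X l j := by
  simp only [sampleCov, Matrix.of_apply, mul_comm]

end SampleContinuity

section EstimatingScheme

/-- A system of estimating equations
`w(γ_j) γ_lᵀ T̂(γ_j) = c w(γ_l) γ_jᵀ T̂(γ_l)` for `j < l`, to be combined with the whitening
constraint.  The weight `w` may depend on the sample and on the index of the row, and `a`, `lm` and
`d` are the population values of `w`, `λ` and `δ`, which fix the preconditioner of the Newton
iteration.  Deflation is `w = 1`, `c = 0`; both symmetric methods have `c = 1`, with a sign or
`ν̂` as the weight. -/
structure EstimatingScheme (p : ℕ) where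
  G : ℝ → ℝ
  weight : ∀ n : ℕ, (Fin n → Fin p → ℝ) → (Fin p → ℝ) → Fin p → ℝ
  c : ℝ
  a : Fin p → ℝ
  lm : Fin p → ℝ
  d : Fin p → ℝ

/-- The matrix with rows the standard unit vectors, as an element of a normed space. -/
def idRows (p : ℕ) : Fin p → Fin p → ℝ := fun j => Pi.single j 1

/-- Deviation from the whitening constraint. -/
def whiteRes {p n : ℕ} (X : Fin n → Fin p → ℝ) (Γ : Fin p → Fin p → ℝ) (j l : Fin p) : ℝ :=
  Γ l ⬝ᵥ (sampleCov X *ᵥ Γ j) - if l = j then 1 else 0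

namespace EstimatingScheme

variable {p n : ℕ} (S : EstimatingScheme p)

/-- The residual of the `(j, l)`-th estimating equation. -/
def critRes (X : Fin n → Fin p → ℝ) (Γ : Fin p → Fin p → ℝ) (j l : Fin p) : ℝ :=
  S.weight n X (Γ j) j * (Γ l ⬝ᵥ hatT S.G X (Γ j)) -
    S.c * (S.weight n X (Γ l) l * (Γ j ⬝ᵥ hatT S.G X (Γ l)))

/-- The population derivative of the `(j, l)`-th residual with respect to the entry `(l, j)`. -/
def kappa (j l : Fin p) : ℝ := S.a j * S.lm j - S.c * (S.a l * S.d l)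

/-- The population derivative of the `(j, l)`-th residual along rotations in the plane of the
`j`-th and `l`-th coordinates, the denominator of the expansions. -/
def slope (j l : Fin p) : ℝ := S.a j * (S.lm j - S.d j) + S.c * (S.a l * (S.lm l - S.d l))

/-- The combination of the two residuals with population derivative `Γ ↦ Γ j l`. -/
def upperRes (X : Fin n → Fin p → ℝ) (Γ : Fin p → Fin p → ℝ) (j l : Fin p) : ℝ :=
  (S.slope j l)⁻¹ * (S.kappa j l * whiteRes X Γ j l - S.critRes X Γ j l)

/-- The residuals of all equations, multiplied by the inverse of their population derivative at the
identity. -/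
def newtonMap (X : Fin n → Fin p → ℝ) (Γ : Fin p → Fin p → ℝ) : Fin p → Fin p → ℝ := fun j l =>
  if j < l then S.upperRes X Γ j l
  else if l < j then whiteRes X Γ l j - S.upperRes X Γ l j
  else 2⁻¹ * whiteRes X Γ j j

/-- The limit of the simplified Newton iteration started at the identity.  The superior limit keeps
it measurable in the sample without having to single out the samples for which the iteration
converges. -/
def newtonLimit (n : ℕ) (X : Fin n → Fin p → ℝ) : Matrix (Fin p) (Fin p) ℝ := fun j l =>
  limsup (fun k => (fun Γ => Γ - S.newtonMap X Γ)^[k] (idRows p) j l) atTop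

end EstimatingScheme

variable {p n : ℕ} {S : EstimatingScheme p}

theorem continuous_whiteRes (j l : Fin p) :
    Continuous fun q : (Fin n → Fin p → ℝ) × (Fin p → Fin p → ℝ) => whiteRes q.1 q.2 j l := by
  have hS : ∀ k m, Continuous fun q : (Fin n → Fin p → ℝ) × (Fin p → Fin p → ℝ) =>
    sampleCov q.1 k m := fun k m => (continuous_sampleCov k m).comp continuous_fst
  simp only [whiteRes, dotProduct, mulVec]
  fun_prop

theorem whiteRes_comm (X : Fin n → Fin p → ℝ) (Γ : Fin p → Fin p → ℝ) (j l : Fin p) :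
    whiteRes X Γ j l = whiteRes X Γ l j := by
  have hS : (sampleCov X)ᵀ = sampleCov X := Matrix.ext fun a b => sampleCov_comm X b a
  have hdot : Γ l ⬝ᵥ (sampleCov X *ᵥ Γ j) = Γ j ⬝ᵥ (sampleCov X *ᵥ Γ l) := by
    rw [dotProduct_mulVec, ← mulVec_transpose, hS, dotProduct_comm]
  simp only [whiteRes, hdot, eq_comm]

namespace EstimatingScheme

theorem continuous_critRes (hg : Continuous (deriv S.G)) (hw : ∀ j,
      Continuous fun q : (Fin n → Fin p → ℝ) × (Fin p → ℝ) => S.weight n q.1 q.2 j)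
    (j l : Fin p) :
    Continuous fun q : (Fin n → Fin p → ℝ) × (Fin p → Fin p → ℝ) => S.critRes q.1 q.2 j l := by
  have hrow : ∀ j, Continuous fun q : (Fin n → Fin p → ℝ) × (Fin p → Fin p → ℝ) =>
      (q.1, q.2 j) := fun j => by fun_prop
  have hT : ∀ j k, Continuous fun q : (Fin n → Fin p → ℝ) × (Fin p → Fin p → ℝ) =>
      hatT S.G q.1 (q.2 j) k := fun j k => by
    have hcomp := (continuous_hatT (n := n) hg k).comp (hrow j)
    exact hcomp
  have hdot : ∀ j l, Continuous fun q : (Fin n → Fin p → ℝ) × (Fin p → Fin p → ℝ) =>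
      q.2 l ⬝ᵥ hatT S.G q.1 (q.2 j) := fun j l => by
    simp only [dotProduct]
    exact continuous_finsetSum _ fun k _ => Continuous.mul (by fun_prop) (hT j k)
  exact (((hw j).comp (hrow j)).mul (hdot j l)).sub
    (continuous_const.mul (((hw l).comp (hrow l)).mul (hdot l j)))

theorem continuous_newtonMap (hg : Continuous (deriv S.G)) (hw : ∀ j,
      Continuous fun q : (Fin n → Fin p → ℝ) × (Fin p → ℝ) => S.weight n q.1 q.2 j) :
    Continuous fun q : (Fin n → Fin p → ℝ) × (Fin p → Fin p → ℝ) => S.newtonMap q.1 q.2 := by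
  have hup : ∀ j l, Continuous fun q : (Fin n → Fin p → ℝ) × (Fin p → Fin p → ℝ) =>
      S.upperRes q.1 q.2 j l := fun j l => continuous_const.mul
    ((continuous_const.mul (continuous_whiteRes j l)).sub (continuous_critRes hg hw j l))
  refine continuous_pi fun j => continuous_pi fun l => ?_
  simp only [newtonMap]
  split_ifs
  · exact hup j l
  · exact (continuous_whiteRes l j).sub (hup l j)
  · exact continuous_const.mul (continuous_whiteRes j j)

theorem measurable_newtonLimit (hg : Continuous (deriv S.G)) (hw : ∀ j,
      Continuous fun q : (Fin n → Fin p → ℝ) × (Fin p → ℝ) => S.weight n q.1 q.2 j)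
    (j l : Fin p) : Measurable fun X => S.newtonLimit n X j l := by
  have hiter : ∀ k, Continuous fun X : Fin n → Fin p → ℝ =>
      (fun Γ => Γ - S.newtonMap X Γ)^[k] (idRows p) := fun k => by
    induction k with
    | zero => exact continuous_const
    | succ k ih =>
      simp only [Function.iterate_succ_apply']
      exact ih.sub ((continuous_newtonMap hg hw).comp (continuous_id.prodMk ih))
  exact .limsup fun k => ((entry j l).continuous.comp (hiter k)).measurable

theorem isWhitening_and_critRes_eq_zero (hD : ∀ j l, j < l → S.slope j l ≠ 0)
    {X : Fin n → Fin p → ℝ} {Γ : Fin p → Fin p → ℝ} (h : S.newtonMap X Γ = 0) :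
    IsWhitening X Γ ∧ ∀ j l, j < l → S.critRes X Γ j l = 0 := by
  have hlt : ∀ j l, j < l → whiteRes X Γ j l = 0 ∧ S.critRes X Γ j l = 0 := by
    intro j l hjl
    have hup : S.upperRes X Γ j l = 0 := by
      simpa only [newtonMap, hjl, if_true, Pi.zero_apply] using congr_fun₂ h j l
    have hlow : whiteRes X Γ j l - S.upperRes X Γ j l = 0 := by
      simpa only [newtonMap, hjl, hjl.not_gt, if_true, if_false, Pi.zero_apply] using
        congr_fun₂ h l j
    have hwhite : whiteRes X Γ j l = 0 := by rwa [hup, sub_zero] at hlow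
    rw [upperRes, hwhite, mul_zero, zero_sub, mul_neg, neg_eq_zero] at hup
    exact ⟨hwhite, (mul_eq_zero.1 hup).resolve_left (inv_ne_zero (hD j l hjl))⟩
  refine ⟨fun j l => sub_eq_zero.1 (?_ : whiteRes X Γ j l = 0), fun j l hjl => (hlt j l hjl).2⟩
  rcases lt_trichotomy j l with hjl | rfl | hjl
  · exact (hlt j l hjl).1
  · have hdiag := congr_fun₂ h j j
    simp only [newtonMap, lt_irrefl, if_false, Pi.zero_apply] at hdiag
    linarith
  · rw [whiteRes_comm]
    exact (hlt l j hjl).1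

end EstimatingScheme

end EstimatingScheme

section LinearizationAtIdentity

variable {p : ℕ} {G : ℝ → ℝ} {m lm d : Fin p → ℝ} {y : ℕ → Fin p → ℝ}
  {X : ∀ n : ℕ, Fin n → Fin p → ℝ} {S : EstimatingScheme p}

theorem idRows_apply (j l : Fin p) : idRows p j l = if l = j then 1 else 0 := by
  simp [idRows, Pi.single_apply]

theorem hasUnifStrictFDerivAt_entry (j l : Fin p) :
    HasUnifStrictFDerivAt atTop (fun (_ : ℕ) Γ => Γ j l) (if l = j then 1 else 0) (entry j l)
      (idRows p) :=
  (HasUnifStrictFDerivAt.clm atTop (entry j l) (idRows p)).congr_deriv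
    (by rw [entry_apply, idRows_apply]) fun _ => rfl

theorem HasUnifStrictFDerivAt.comp_row {f : ℕ → (Fin p → ℝ) → ℝ} {c : ℝ}
    {L : (Fin p → ℝ) →L[ℝ] ℝ} {j : Fin p}
    (h : HasUnifStrictFDerivAt atTop f c L (Pi.single j 1)) :
    HasUnifStrictFDerivAt atTop (fun n Γ => f n (Γ j)) c
      (L.comp (ContinuousLinearMap.proj (R := ℝ) (φ := fun _ : Fin p => Fin p → ℝ) j))
      (idRows p) :=
  HasUnifStrictFDerivAt.comp (c := (Pi.single j 1 : Fin p → ℝ)) h (HasUnifStrictFDerivAt.clm atTop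
    (ContinuousLinearMap.proj (R := ℝ) (φ := fun _ : Fin p => Fin p → ℝ) j) (idRows p))

theorem HasUnifStrictFDerivAt.comp_prodMk {f : ℕ → DirCentre p → ℝ} {c : ℝ}
    {L : DirCentre p →L[ℝ] ℝ} {j : Fin p} {u : ℕ → Fin p → ℝ}
    (h : HasUnifStrictFDerivAt atTop f c L (axis j)) (hu : Tendsto u atTop (𝓝 0)) :
    HasUnifStrictFDerivAt atTop (fun n γ => f n (γ, u n)) c
      (L.comp (ContinuousLinearMap.inl ℝ (Fin p → ℝ) (Fin p → ℝ))) (Pi.single j 1) :=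
  h.comp ⟨tendsto_const_nhds.prodMk_nhds hu, by simp⟩

theorem IsRegularSequence.hasUnifStrictFDerivAt_whiteRes (hy : IsRegularSequence G m lm d y)
    (hX : IsTranslate y X) (j l : Fin p) :
    HasUnifStrictFDerivAt atTop (fun n Γ => whiteRes (X n) Γ j l) 0 (entry l j + entry j l)
      (idRows p) := by
  have hrow : ∀ k, HasUnifStrictFDerivAt atTop
      (fun n (Γ : Fin p → Fin p → ℝ) => ∑ m, sampleCov (X n) k m * Γ j m) _ _ (idRows p) :=
    fun k => .sum fun m _ => (HasUnifStrictFDerivAt.of_tendsto (hy.tendsto_sampleCov hX k m)).mul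
      (hasUnifStrictFDerivAt_entry j m)
  have hquad : HasUnifStrictFDerivAt atTop
      (fun n (Γ : Fin p → Fin p → ℝ) => ∑ k, Γ l k * ∑ m, sampleCov (X n) k m * Γ j m) _ _
      (idRows p) := .sum fun k _ => (hasUnifStrictFDerivAt_entry l k).mul (hrow k)
  refine (hquad.sub (.of_tendsto (tendsto_const_nhds (x := if l = j then (1 : ℝ) else 0))))
    |>.congr_deriv ?_ fun Δ => ?_
  · simp [@eq_comm _ j l]
  · simp [Finset.sum_add_distrib, add_comm]

theorem IsRegularSequence.hasUnifStrictFDerivAt_dotProduct_hatT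
    (hy : IsRegularSequence G m lm d y) (hX : IsTranslate y X) {j l : Fin p} (hlj : l ≠ j) :
    HasUnifStrictFDerivAt atTop (fun n Γ => Γ l ⬝ᵥ hatT G (X n) (Γ j)) 0
      (lm j • entry l j + d j • entry j l) (idRows p) := by
  choose L hL hT using fun k => hy.avgT j k
  have hrow : ∀ k, HasUnifStrictFDerivAt atTop
      (fun n (Γ : Fin p → Fin p → ℝ) => hatT G (X n) (Γ j) k) _ _ (idRows p) := fun k => by
    simp only [hX.hatT_apply]
    exact ((hT k).comp_prodMk hy.mean).comp_row
  refine HasUnifStrictFDerivAt.congr_deriv (.sum fun k _ =>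
    (hasUnifStrictFDerivAt_entry l k).mul (hrow k)) ?_ fun Δ => ?_
  · simp [hlj.symm]
  · simp [Finset.sum_add_distrib, hL l hlj, add_comm, entry_apply]

end LinearizationAtIdentity

section Expansion

variable {p : ℕ} {S : EstimatingScheme p} {m : Fin p → ℝ} {y : ℕ → Fin p → ℝ}
  {X : ∀ n : ℕ, Fin n → Fin p → ℝ}

namespace EstimatingScheme

/-- The scheme `S` can be linearized at the identity along the samples `X n`, which are translates
of an initial segment of a regular sequence `y`. -/
structure IsRegular (S : EstimatingScheme p) (m : Fin p → ℝ) (y : ℕ → Fin p → ℝ)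
    (X : ∀ n : ℕ, Fin n → Fin p → ℝ) : Prop where
  isRegularSequence : IsRegularSequence S.G m S.lm S.d y
  isTranslate : IsTranslate y X
  weight : ∀ j, ∃ L : (Fin p → ℝ) →L[ℝ] ℝ,
    HasUnifStrictFDerivAt atTop (fun n γ => S.weight n (X n) γ j) (S.a j) L (Pi.single j 1)

namespace IsRegular

theorem hasUnifStrictFDerivAt_critRes (h : S.IsRegular m y X) {j l : Fin p} (hlj : l ≠ j) :
    HasUnifStrictFDerivAt atTop (fun n Γ => S.critRes (X n) Γ j l) 0
      (S.a j • (S.lm j • entry l j + S.d j • entry j l) -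
        S.c • S.a l • (S.lm l • entry j l + S.d l • entry l j)) (idRows p) := by
  obtain ⟨L, hL⟩ := h.weight j
  obtain ⟨M, hM⟩ := h.weight l
  have hT {j l : Fin p} (hlj : l ≠ j) :=
    h.isRegularSequence.hasUnifStrictFDerivAt_dotProduct_hatT h.isTranslate hlj
  exact ((hL.comp_row.mul (hT hlj)).sub
    ((hM.comp_row.mul (hT hlj.symm)).const_mul S.c)).congr_deriv (by simp) fun Δ => by simp

theorem hasUnifStrictFDerivAt_upperRes (h : S.IsRegular m y X) {j l : Fin p} (hlj : l ≠ j)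
    (hD : S.slope j l ≠ 0) :
    HasUnifStrictFDerivAt atTop (fun n Γ => S.upperRes (X n) Γ j l) 0 (entry j l) (idRows p) := by
  have hwhite := h.isRegularSequence.hasUnifStrictFDerivAt_whiteRes h.isTranslate j l
  refine (((hwhite.const_mul (S.kappa j l)).sub
    (h.hasUnifStrictFDerivAt_critRes hlj)).const_mul (S.slope j l)⁻¹).congr_deriv (by simp)
    fun Δ => ?_
  simp only [_root_.smul_apply, _root_.sub_apply, _root_.add_apply, smul_eq_mul]
  rw [inv_mul_eq_iff_eq_mul₀ hD, kappa, slope]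
  ring

theorem hasUnifStrictFDerivAt_newtonMap (h : S.IsRegular m y X)
    (hD : ∀ j l, j < l → S.slope j l ≠ 0) :
    HasUnifStrictFDerivAt atTop (fun n Γ => S.newtonMap (X n) Γ) 0 (.id ℝ _) (idRows p) := by
  have hwhite := h.isRegularSequence.hasUnifStrictFDerivAt_whiteRes h.isTranslate
  refine .pi fun j => .pi fun l => ?_
  simp only [newtonMap]
  rcases lt_trichotomy j l with hjl | rfl | hjl
  · simp only [hjl, if_true]
    exact (h.hasUnifStrictFDerivAt_upperRes hjl.ne' (hD j l hjl)).congr_deriv rfl fun _ => rfl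
  · simp only [lt_irrefl, if_false]
    refine ((hwhite j j).const_mul 2⁻¹).congr_deriv (by simp) fun Δ => ?_
    change 2⁻¹ * (Δ j j + Δ j j) = Δ j j
    ring
  · simp only [hjl, hjl.not_gt, if_true, if_false]
    refine ((hwhite l j).sub
      (h.hasUnifStrictFDerivAt_upperRes hjl.ne' (hD l j hjl))).congr_deriv (by simp) fun Δ => ?_
    change Δ j l + Δ l j - Δ l j = Δ j l
    ring

end IsRegular

end EstimatingScheme

theorem whiteRes_idRows {n : ℕ} (X : Fin n → Fin p → ℝ) (j l : Fin p) :
    whiteRes X (idRows p) j l = sampleCov X j l - if j = l then 1 else 0 := by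
  simp only [whiteRes, idRows, single_dotProduct, one_mul, mulVec_single_one, Matrix.col_apply]
  rw [sampleCov_comm]
  simp only [eq_comm]

namespace EstimatingScheme

theorem critRes_idRows {n : ℕ} (S : EstimatingScheme p) (X : Fin n → Fin p → ℝ) (j l : Fin p) :
    S.critRes X (idRows p) j l =
      S.weight n X (Pi.single j 1) j * hatT S.G X (Pi.single j 1) l -
        S.c * (S.weight n X (Pi.single l 1) l * hatT S.G X (Pi.single l 1) j) := by
  simp only [critRes, idRows, single_dotProduct, one_mul]

namespace IsRegular

theorem isBigO_whiteRes_idRows (h : S.IsRegular m y X) (j l : Fin p) :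
    (fun n => whiteRes (X n) (idRows p) j l) =O[atTop] fluctuation S.G m y := by
  simp only [whiteRes_idRows]
  exact h.isRegularSequence.isBigO_sampleCov_sub h.isTranslate j l

theorem isLittleO_weight_mul_hatT_sub (h : S.IsRegular m y X) {j l : Fin p} (hlj : l ≠ j) :
    (fun n => S.weight n (X n) (Pi.single j 1) j * hatT S.G (X n) (Pi.single j 1) l -
      S.a j * srcT S.G (m j) (fun i : Fin n => y i) j l) =o[atTop] fluctuation S.G m y := by
  obtain ⟨L, hL⟩ := h.weight j
  have hw : (fun n => S.weight n (X n) (Pi.single j 1) j - S.a j) =o[atTop] fun _ => (1 : ℝ) :=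
    (isLittleO_one_iff ℝ).2 (tendsto_sub_nhds_zero_iff.2 hL.tendsto)
  have hwT : (fun n => (S.weight n (X n) (Pi.single j 1) j - S.a j) *
      hatT S.G (X n) (Pi.single j 1) l) =o[atTop] fluctuation S.G m y := by
    simpa using hw.mul_isBigO (h.isRegularSequence.isBigO_hatT h.isTranslate hlj).norm_right
  refine (hwT.add ((h.isRegularSequence.isLittleO_hatT_sub_srcT h.isTranslate hlj).const_mul_left
    (S.a j))).congr_left fun n => ?_
  ring

theorem isLittleO_critRes_idRows_sub (h : S.IsRegular m y X) {j l : Fin p} (hlj : l ≠ j) :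
    (fun n => S.critRes (X n) (idRows p) j l -
      (S.a j * srcT S.G (m j) (fun i : Fin n => y i) j l -
        S.c * (S.a l * srcT S.G (m l) (fun i : Fin n => y i) l j)))
      =o[atTop] fluctuation S.G m y := by
  refine ((h.isLittleO_weight_mul_hatT_sub hlj).sub
    ((h.isLittleO_weight_mul_hatT_sub hlj.symm).const_mul_left S.c)).congr_left fun n => ?_
  rw [critRes_idRows]
  ring

theorem isBigO_upperRes_idRows (h : S.IsRegular m y X) {j l : Fin p} (hlj : l ≠ j) :
    (fun n => S.upperRes (X n) (idRows p) j l) =O[atTop] fluctuation S.G m y := by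
  have hcrit : (fun n => S.critRes (X n) (idRows p) j l) =O[atTop] fluctuation S.G m y := by
    simpa only [sub_add_cancel] using (h.isLittleO_critRes_idRows_sub hlj).isBigO.add
      (((isBigO_srcT_fluctuation S.G m y hlj).const_mul_left (S.a j)).sub
        (((isBigO_srcT_fluctuation S.G m y hlj.symm).const_mul_left (S.a l)).const_mul_left S.c))
  exact (((h.isBigO_whiteRes_idRows j l).const_mul_left _).sub hcrit).const_mul_left _

theorem isBigO_newtonMap_idRows (h : S.IsRegular m y X) :
    (fun n => S.newtonMap (X n) (idRows p)) =O[atTop] fluctuation S.G m y := by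
  refine isBigO_pi.2 fun j => isBigO_pi.2 fun l => ?_
  simp only [newtonMap]
  rcases lt_trichotomy j l with hjl | rfl | hjl
  · simpa only [hjl, if_true] using h.isBigO_upperRes_idRows hjl.ne'
  · simpa only [lt_irrefl, if_false] using (h.isBigO_whiteRes_idRows j j).const_mul_left _
  · simpa only [hjl, hjl.not_gt, if_true, if_false] using
      (h.isBigO_whiteRes_idRows l j).sub (h.isBigO_upperRes_idRows hjl.ne')

theorem newtonLimit_spec (h : S.IsRegular m y X) (hD : ∀ j l, j < l → S.slope j l ≠ 0) :
    (∀ᶠ n in atTop, S.newtonMap (X n) (S.newtonLimit n (X n)) = 0) ∧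
    Tendsto (fun n => (S.newtonLimit n (X n) : Fin p → Fin p → ℝ)) atTop (𝓝 (idRows p)) ∧
    ∀ j l, (fun n => S.newtonLimit n (X n) j l - idRows p j l +
      S.newtonMap (X n) (idRows p) j l) =o[atTop] fluctuation S.G m y := by
  obtain ⟨Γ, hΓ, hlim, hexp⟩ :=
    exists_zero_of_hasUnifStrictFDerivAt_id (h.hasUnifStrictFDerivAt_newtonMap hD)
  have heq : Γ =ᶠ[atTop] fun n => (S.newtonLimit n (X n) : Fin p → Fin p → ℝ) := by
    filter_upwards [hΓ] with n hn
    ext j l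
    exact (tendsto_pi_nhds.1 (tendsto_pi_nhds.1 hn.2 j) l).limsup_eq.symm
  refine ⟨?_, hlim.congr' heq, fun j l => ?_⟩
  · filter_upwards [hΓ, heq] with n hn hn'
    rw [← hn.1, hn']
  · refine (isLittleO_pi.1 (isLittleO_pi.1 (hexp.trans_isBigO h.isBigO_newtonMap_idRows) j)
      l).congr' ?_ EventuallyEq.rfl
    filter_upwards [heq] with n hn
    simp only [Pi.add_apply, hn]
    rfl

theorem isLittleO_newtonLimit_diag (h : S.IsRegular m y X)
    (hD : ∀ j l, j < l → S.slope j l ≠ 0) (j : Fin p) :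
    (fun n => S.newtonLimit n (X n) j j - 1 - -(1 / 2) * (sampleCov (X n) j j - 1))
      =o[atTop] fluctuation S.G m y := by
  refine ((h.newtonLimit_spec hD).2.2 j j).congr_left fun n => ?_
  simp only [newtonMap, lt_irrefl, if_false, whiteRes_idRows, idRows_apply, if_true]
  ring

theorem isLittleO_newtonLimit_upper (h : S.IsRegular m y X)
    (hD : ∀ j l, j < l → S.slope j l ≠ 0) {j l : Fin p} (hjl : j < l) :
    (fun n => S.newtonLimit n (X n) j l -
      (S.a j * srcT S.G (m j) (fun i : Fin n => y i) j l -
        S.c * (S.a l * srcT S.G (m l) (fun i : Fin n => y i) l j) -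
        S.kappa j l * sampleCov (X n) j l) / S.slope j l) =o[atTop] fluctuation S.G m y := by
  refine (((h.newtonLimit_spec hD).2.2 j l).add ((h.isLittleO_critRes_idRows_sub
    hjl.ne').const_mul_left (S.slope j l)⁻¹)).congr_left fun n => ?_
  simp only [newtonMap, upperRes, hjl, if_true, whiteRes_idRows, idRows_apply, hjl.ne, hjl.ne',
    if_false]
  ring

theorem isLittleO_newtonLimit_lower (h : S.IsRegular m y X)
    (hD : ∀ j l, j < l → S.slope j l ≠ 0) {j l : Fin p} (hlj : l < j) :
    (fun n => S.newtonLimit n (X n) j l - (-S.newtonLimit n (X n) l j - sampleCov (X n) j l))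
      =o[atTop] fluctuation S.G m y := by
  refine (((h.newtonLimit_spec hD).2.2 j l).add ((h.newtonLimit_spec hD).2.2 l j)).congr_left
    fun n => ?_
  simp only [newtonMap, hlj, hlj.not_gt, if_true, if_false, whiteRes_idRows, idRows_apply, hlj.ne,
    hlj.ne', sampleCov_comm (X n) l j]
  ring

theorem isLittleO_newtonLimit_offDiag (h : S.IsRegular m y X) (hc : S.c = 1)
    (hD : ∀ j l, l ≠ j → S.slope j l ≠ 0) {j l : Fin p} (hlj : l ≠ j) :
    (fun n => S.newtonLimit n (X n) j l -
      (S.a j * srcT S.G (m j) (fun i : Fin n => y i) j l -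
        S.a l * srcT S.G (m l) (fun i : Fin n => y i) l j -
        S.kappa j l * sampleCov (X n) j l) / S.slope j l) =o[atTop] fluctuation S.G m y := by
  have hDlt : ∀ j l, j < l → S.slope j l ≠ 0 := fun j l hjl => hD j l hjl.ne'
  rcases hlj.lt_or_gt with hlt | hlt
  · refine ((h.isLittleO_newtonLimit_lower hDlt hlt).sub
      (h.isLittleO_newtonLimit_upper hDlt hlt)).congr_left fun n => ?_
    have hne := hD j l hlj
    have hsymm : S.slope l j = S.slope j l := by
      rw [slope, slope, hc]
      ring
    have hkappa : S.kappa j l + S.kappa l j = S.slope j l := by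
      rw [kappa, kappa, slope, hc]
      ring
    rw [hsymm, sampleCov_comm (X n) l j, hc]
    field_simp
    rw [← hkappa]
    ring
  · simpa only [hc, one_mul] using h.isLittleO_newtonLimit_upper hDlt hlt

end IsRegular

end EstimatingScheme

end Expansion

section AlmostSure

variable {Ω : Type*} [MeasurableSpace Ω] {P : Measure Ω} {p : ℕ} {G : ℝ → ℝ}
  {loc : Fin p → ℝ} {x z : ℕ → Ω → Fin p → ℝ}

theorem IsICSample.isTranslate (hmodel : IsICSample P loc 1 x z) (ω : Ω) :
    IsTranslate (fun i => z i ω) fun n => firstObs x n ω := by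
  intro n i
  have hn : n ≠ 0 := (Nat.zero_lt_of_lt i.isLt).ne'
  have hx : ∀ i, x i ω = loc + z i ω := fun i => by rw [hmodel.model, one_mulVec]
  have hmean : sampleMean (firstObs x n ω) = loc + empMean (fun i => z i ω) n := by
    ext k
    rw [Pi.add_apply, empMean_apply, empMean_eq_smul_sum_fin]
    simp only [sampleMean, firstObs, hx, Pi.add_apply, Finset.sum_add_distrib, Finset.sum_const,
      Finset.card_univ, Fintype.card_fin, smul_eq_mul, nsmul_eq_mul, mul_add]
    rw [inv_mul_cancel_left₀ (Nat.cast_ne_zero.2 hn)]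
  rw [hmean]
  simp only [firstObs, hx, add_sub_add_left_eq_sub]

theorem measurable_firstObs (hz : ∀ i, Measurable (z i)) (n : ℕ) : Measurable (firstObs z n) :=
  measurable_pi_lambda _ fun i => hz i

theorem IsICSample.measurable_obs (hmodel : IsICSample P loc 1 x z) (i : ℕ) :
    Measurable (x i) := by
  have hx : x i = fun ω => loc + z i ω := by
    funext ω
    rw [hmodel.model, one_mulVec]
  rw [hx]
  exact (hmodel.measurable i).const_add loc

theorem integral_mul_of_isStandardized {y₀ : Ω → Fin p → ℝ} (hm : Measurable y₀)
    (hind : iIndepFun (fun (j : Fin p) ω => y₀ ω j) P) (hA2 : IsStandardized P y₀) (k l : Fin p) :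
    ∫ ω, y₀ ω k * y₀ ω l ∂P = if k = l then 1 else 0 := by
  split_ifs with hkl
  · subst hkl
    simpa only [sq] using (hA2 k).2.2
  · exact integral_comp_mul_eq_zero hm hind hA2 measurable_id (Ne.symm hkl)

theorem IsICSample.ae_isRegularSequence [IsFiniteMeasure P] (hG : ContDiff ℝ 2 G)
    (hmodel : IsICSample P loc 1 x z) (hA2 : IsStandardized P (z 0))
    (hA3 : HasMoments P G (z 0)) (hdom : IsLocallyDominated P G (z 0)) :
    ∀ᵐ ω ∂P, IsRegularSequence G (mu P G (z 0)) (lam P G (z 0)) (del P G (z 0))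
      fun i => z i ω := by
  have hmean : ∀ᵐ ω ∂P, ∀ k, Tendsto (empMean fun i => z i ω k) atTop (𝓝 0) := by
    refine ae_all_iff.2 fun k => ?_
    simpa only [(hA2 k).2.1] using ae_tendsto_empMean hmodel.indep_sample hmodel.identDistrib
      (φ := fun y : Fin p → ℝ => y k) (measurable_pi_apply k) ((hA2 k).1.integrable one_le_two)
  have hsecond : ∀ᵐ ω ∂P, ∀ k l, Tendsto (empMean fun i => z i ω k * z i ω l) atTop
      (𝓝 (if k = l then 1 else 0)) := by
    refine ae_all_iff.2 fun k => ae_all_iff.2 fun l => ?_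
    simpa only [integral_mul_of_isStandardized (hmodel.measurable 0) hmodel.indep_components hA2]
      using ae_tendsto_empMean hmodel.indep_sample hmodel.identDistrib
        (φ := fun y : Fin p → ℝ => y k * y l) (by fun_prop) ((hA2 k).1.integrable_mul (hA2 l).1)
  choose L hL hT using fun j l => ae_hasUnifStrictFDerivAt_avgT hG hmodel hA2 hA3 hdom j l
  filter_upwards [hmean, hsecond, ae_all_iff.2 fun j => ae_all_iff.2 fun l => hT j l]
    with ω hω₁ hω₂ hω₃
  refine ⟨tendsto_pi_nhds.2 fun k => ?_, hω₂, fun j l => ⟨L j l, hL j l, hω₃ j l⟩⟩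
  simpa only [empMean_apply, Pi.zero_apply] using hω₁ k

theorem IsICSample.ae_hasUnifStrictFDerivAt_hatG [IsFiniteMeasure P] (hG : ContDiff ℝ 2 G)
    (hmodel : IsICSample P loc 1 x z) (hA2 : IsStandardized P (z 0))
    (hA3 : HasMoments P G (z 0)) (hdom : IsLocallyDominated P G (z 0)) :
    ∀ᵐ ω ∂P, ∀ j, ∃ L : (Fin p → ℝ) →L[ℝ] ℝ,
      HasUnifStrictFDerivAt atTop (fun n γ => hatG G (firstObs x n ω) γ) (nu P G (z 0) j) L
        (Pi.single j 1) := by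
  choose L hL using ae_hasUnifStrictFDerivAt_avgG hG hmodel hA2 hA3 hdom
  filter_upwards [hmodel.ae_isRegularSequence hG hA2 hA3 hdom, ae_all_iff.2 hL] with ω hω hLω j
  simp only [(hmodel.isTranslate ω).hatG_eq]
  exact ⟨_, (hLω j).comp_prodMk hω.mean⟩

end AlmostSure

section FluctuationOrder

variable {Ω : Type*} [MeasurableSpace Ω] {P : Measure Ω} {p : ℕ} {G : ℝ → ℝ}

theorem measurable_fluctTerm (hg : Continuous (deriv G)) (m : Fin p → ℝ) :
    Measurable (fluctTerm G m) := by
  have hlast : ∀ j l, Measurable fun y : Fin p → ℝ =>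
      if l = j then 0 else (deriv G (y j) - m j) * y l := fun j l => by
    split_ifs
    · exact measurable_const
    · exact ((hg.measurable.comp (measurable_pi_apply j)).sub_const _).mul (measurable_pi_apply l)
  unfold fluctTerm
  fun_prop

theorem measurable_fluctuation (hg : Continuous (deriv G)) {z : ℕ → Ω → Fin p → ℝ}
    (hz : ∀ i, Measurable (z i)) (m : Fin p → ℝ) (n : ℕ) :
    Measurable fun ω => fluctuation G m (fun i => z i ω) n := by
  simp only [fluctuation, empMean]
  exact (Finset.measurable_fun_sum _ fun i _ =>
    (measurable_fluctTerm hg m).comp (hz i)).fun_const_smul _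

theorem memLp_two_mul {f g : Ω → ℝ} (hf : AEStronglyMeasurable f P)
    (hg : AEStronglyMeasurable g P) (hf4 : Integrable (fun ω => f ω ^ 4) P)
    (hg4 : Integrable (fun ω => g ω ^ 4) P) : MemLp (fun ω => f ω * g ω) 2 P := by
  refine (memLp_two_iff_integrable_sq (hf.mul hg)).2 ?_
  refine (hf4.add hg4).mono' ((hf.mul hg).pow 2) (ae_of_all _ fun ω => ?_)
  rw [Real.norm_of_nonneg (sq_nonneg _), Pi.add_apply, Pi.mul_apply]
  nlinarith [sq_nonneg (f ω ^ 2 - g ω ^ 2), sq_nonneg (f ω ^ 2), sq_nonneg (g ω ^ 2)]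

variable [IsProbabilityMeasure P] {loc : Fin p → ℝ} {A : Matrix (Fin p) (Fin p) ℝ}
  {x z : ℕ → Ω → Fin p → ℝ}

theorem IsICSample.isRootBounded_empMean_comp (hmodel : IsICSample P loc A x z)
    {φ : (Fin p → ℝ) → ℝ} (hφ : Measurable φ) (h2 : MemLp (fun ω => φ (z 0 ω)) 2 P)
    (h0 : ∫ ω, φ (z 0 ω) ∂P = 0) : IsRootBounded P fun n ω => empMean (fun i => φ (z i ω)) n :=
  isRootBounded_empMean (X := fun i ω => φ (z i ω)) h2 h0
    (fun _ _ hij => (hmodel.indep_sample.indepFun hij).comp hφ hφ)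
    fun i => (hmodel.identDistrib i).comp hφ

theorem IsICSample.isRootBounded_empMean_mul (hmodel : IsICSample P loc A x z)
    (hA2 : IsStandardized P (z 0)) (hA3 : HasMoments P G (z 0)) (j l : Fin p) :
    IsRootBounded P fun n ω =>
      empMean (fun i => z i ω j * z i ω l - if j = l then 1 else 0) n := by
  have hz : ∀ k, Measurable fun ω => z 0 ω k := measurable_pi_iff.1 (hmodel.measurable 0)
  have hL2 := memLp_two_mul (hz j).aestronglyMeasurable (hz l).aestronglyMeasurable
    (hA3.beta j) (hA3.beta l)
  refine hmodel.isRootBounded_empMean_comp (φ := fun y => y j * y l - if j = l then 1 else 0)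
    (by fun_prop) (hL2.sub (memLp_const _)) ?_
  rw [integral_sub (hL2.integrable one_le_two) (integrable_const _),
    integral_mul_of_isStandardized (hmodel.measurable 0) hmodel.indep_components hA2]
  simp

theorem IsICSample.isRootBounded_empMean_score (hg : Continuous (deriv G))
    (hmodel : IsICSample P loc A x z) (hA2 : IsStandardized P (z 0))
    (hA3 : HasMoments P G (z 0)) (a : ℝ) {j l : Fin p} (hlj : l ≠ j) :
    IsRootBounded P fun n ω => empMean (fun i => (deriv G (z i ω j) - a) * z i ω l) n := by
  have hz : ∀ k, Measurable fun ω => z 0 ω k := measurable_pi_iff.1 (hmodel.measurable 0)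
  have hscore : Measurable fun t => deriv G t - a := hg.measurable.sub_const _
  have hscoreL2 : MemLp (fun ω => deriv G (z 0 ω j) - a) 2 P :=
    ((memLp_two_iff_integrable_sq (hg.measurable.comp (hz j)).aestronglyMeasurable).2
      (hA3.sigma j)).sub (memLp_const _)
  have hindep : IndepFun (fun ω => (deriv G (z 0 ω j) - a) ^ 2) (fun ω => z 0 ω l ^ 2) P :=
    (hmodel.indep_components.indepFun hlj.symm).comp (hscore.pow_const 2)
      (measurable_id.pow_const 2)
  refine hmodel.isRootBounded_empMean_comp (φ := fun y => (deriv G (y j) - a) * y l)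
    (by fun_prop) ?_
    (integral_comp_mul_eq_zero (hmodel.measurable 0) hmodel.indep_components hA2 hscore hlj)
  refine (memLp_two_iff_integrable_sq
    ((hscore.comp (hz j)).mul (hz l)).aestronglyMeasurable).2 ?_
  simpa only [Pi.mul_apply, Function.comp_apply, mul_pow] using!
    hindep.integrable_mul hscoreL2.integrable_sq (hA2 l).1.integrable_sq

theorem IsICSample.isRootBounded_fluctuation (hg : Continuous (deriv G))
    (hmodel : IsICSample P loc A x z) (hA2 : IsStandardized P (z 0))
    (hA3 : HasMoments P G (z 0)) (m : Fin p → ℝ) :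
    IsRootBounded P fun n ω => fluctuation G m (fun i => z i ω) n := by
  have hmean : IsRootBounded P fun n ω => empMean (fun i => z i ω) n := .pi fun k => by
    simpa only [empMean_apply] using hmodel.isRootBounded_empMean_comp
      (φ := fun y : Fin p → ℝ => y k) (measurable_pi_apply k) (hA2 k).1 (hA2 k).2.1
  have hsecond : IsRootBounded P fun n ω =>
      empMean (fun i j l => z i ω j * z i ω l - if j = l then 1 else 0) n :=
    .pi fun j => .pi fun l => by
      simpa only [empMean_apply] using hmodel.isRootBounded_empMean_mul hA2 hA3 j l
  have hscore : IsRootBounded P fun n ω =>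
      empMean (fun i j l => if l = j then 0 else (deriv G (z i ω j) - m j) * z i ω l) n := by
    refine .pi fun j => .pi fun l => ?_
    simp only [empMean_apply]
    split_ifs with hlj
    · simpa [empMean] using isRootBounded_zero
    · exact hmodel.isRootBounded_empMean_score hg hA2 hA3 (m j) hlj
  simpa only [fluctuation, fluctTerm, empMean_prodMk] using hmean.prodMk (hsecond.prodMk hscore)

end FluctuationOrder

section Solutions

variable {n p : ℕ} {G : ℝ → ℝ} {X : Fin n → Fin p → ℝ} {Γ : Matrix (Fin p) (Fin p) ℝ}

theorem IsWhitening.sampleCov_mul_transpose_mul (hW : IsWhitening X Γ) :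
    sampleCov X * (Γᵀ * Γ) = 1 := by
  have hmul : Γ * (sampleCov X * Γᵀ) = 1 := by
    ext l k
    rw [Matrix.one_apply, ← hW k l]
    simp only [Matrix.mul_apply, dotProduct, mulVec, Matrix.transpose_apply]
  rw [← Matrix.mul_assoc, mul_eq_one_comm.1 hmul]

theorem transpose_mul_self_eq_sum_vecMulVec {m k R : Type*} [Fintype m] [CommSemiring R]
    (A : Matrix m k R) : Aᵀ * A = ∑ l, vecMulVec (A l) (A l) := by
  ext a b
  simp [Matrix.mul_apply, Matrix.sum_apply, vecMulVec_apply]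

theorem IsWhitening.isDeflationSolution (hW : IsWhitening X Γ)
    (h : ∀ j l, j < l → Γ l ⬝ᵥ hatT G X (Γ j) = 0) : IsDeflationSolution G X Γ := by
  refine ⟨fun j => ?_, hW⟩
  have hsum : (∑ l ∈ Finset.Iic j, vecMulVec (Γ l) (Γ l)) *ᵥ hatT G X (Γ j) =
      (Γᵀ * Γ) *ᵥ hatT G X (Γ j) := by
    rw [transpose_mul_self_eq_sum_vecMulVec, Matrix.sum_mulVec, Matrix.sum_mulVec]
    refine Finset.sum_subset (Finset.subset_univ _) fun l _ hl => ?_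
    rw [vecMulVec_mulVec, h j l (by simpa using hl), MulOpposite.op_zero, zero_smul]
  rw [hsum, mulVec_mulVec, hW.sampleCov_mul_transpose_mul, one_mulVec]

theorem eventually_sign_eq {α : Type*} {f : Filter α} {u : α → ℝ} {c : ℝ}
    (hu : Tendsto u f (𝓝 c)) (hc : c ≠ 0) : ∀ᶠ n in f, Real.sign (u n) = Real.sign c := by
  rcases hc.lt_or_gt with hc | hc
  · filter_upwards [hu.eventually_lt_const hc] with n hn
    rw [Real.sign_of_neg hn, Real.sign_of_neg hc]
  · filter_upwards [hu.eventually_const_lt hc] with n hn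
    rw [Real.sign_of_pos hn, Real.sign_of_pos hc]

theorem EstimatingScheme.weight_mul_eq_of_critRes_eq_zero {S : EstimatingScheme p} (hc : S.c = 1)
    (h : ∀ j l, j < l → S.critRes X Γ j l = 0) (j l : Fin p) :
    S.weight n X (Γ j) j * (Γ l ⬝ᵥ hatT S.G X (Γ j)) =
      S.weight n X (Γ l) l * (Γ j ⬝ᵥ hatT S.G X (Γ l)) := by
  simp only [critRes, hc, one_mul, sub_eq_zero] at h
  rcases lt_trichotomy j l with hjl | rfl | hjl
  exacts [h j l hjl, rfl, (h l j hjl).symm]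

end Solutions

section Estimators

variable {Ω : Type*} [MeasurableSpace Ω] {P : Measure Ω} {p : ℕ} {x z : ℕ → Ω → Fin p → ℝ}

theorem IsConsistentSolution.mono
    {Sol Sol' : ∀ n : ℕ, (Fin n → Fin p → ℝ) → Matrix (Fin p) (Fin p) ℝ → Prop}
    {est : ∀ n : ℕ, (Fin n → Fin p → ℝ) → Matrix (Fin p) (Fin p) ℝ}
    (h : IsConsistentSolution P x Sol est)
    (hSol : ∀ᵐ ω ∂P, (∀ j l, Tendsto (fun n => est n (firstObs x n ω) j l) atTop
        (𝓝 ((1 : Matrix (Fin p) (Fin p) ℝ) j l))) →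
      ∀ᶠ n in atTop, Sol n (firstObs x n ω) (est n (firstObs x n ω)) →
        Sol' n (firstObs x n ω) (est n (firstObs x n ω))) :
    IsConsistentSolution P x Sol' est := by
  refine ⟨h.1, ?_⟩
  filter_upwards [h.2, hSol] with ω hω hSolω
  refine ⟨?_, hω.2⟩
  filter_upwards [hω.1, hSolω hω.2] with n hn hn'
  exact hn' hn

namespace EstimatingScheme

/-- The scheme with given weights whose preconditioner is taken from the population values of the
source vector `z`. -/
def population (P : Measure Ω) (G : ℝ → ℝ) (z : Ω → Fin p → ℝ) (c : ℝ)
    (weight : ∀ n : ℕ, (Fin n → Fin p → ℝ) → (Fin p → ℝ) → Fin p → ℝ) (a : Fin p → ℝ) :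
    EstimatingScheme p where
  G := G
  weight := weight
  c := c
  a := a
  lm := lam P G z
  d := del P G z

/-- Deflation-based FastICA. -/
def deflation (P : Measure Ω) (G : ℝ → ℝ) (z : Ω → Fin p → ℝ) : EstimatingScheme p :=
  population P G z 0 (fun _ _ _ _ => 1) fun _ => 1

/-- Symmetric FastICA, with the population signs as weights in place of the empirical ones, which
eventually agree with them. -/
def symmetric (P : Measure Ω) (G : ℝ → ℝ) (z : Ω → Fin p → ℝ) : EstimatingScheme p :=
  population P G z 1 (fun _ _ _ => sgn P G z) (sgn P G z)

/-- Squared symmetric FastICA. -/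
def squaredSymmetric (P : Measure Ω) (G : ℝ → ℝ) (z : Ω → Fin p → ℝ) : EstimatingScheme p :=
  population P G z 1 (fun _ X γ _ => hatG G X γ) (nu P G z)

section SlopeKappa

variable (P) (G : ℝ → ℝ) (z : Ω → Fin p → ℝ) (j l : Fin p)

theorem slope_deflation : (deflation P G z).slope j l = lam P G z j - del P G z j := by
  simp [slope, deflation, population]

theorem kappa_deflation : (deflation P G z).kappa j l = lam P G z j := by
  simp only [kappa, deflation, population, one_mul, zero_mul, sub_zero]

theorem slope_symmetric : (symmetric P G z).slope j l =
    (lam P G z j - del P G z j) * sgn P G z j + (lam P G z l - del P G z l) * sgn P G z l := by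
  simp only [slope, symmetric, population]
  ring

theorem kappa_symmetric : (symmetric P G z).kappa j l =
    lam P G z j * sgn P G z j - del P G z l * sgn P G z l := by
  simp only [kappa, symmetric, population]
  ring

theorem slope_squaredSymmetric : (squaredSymmetric P G z).slope j l =
    nu P G z j * (lam P G z j - del P G z j) + nu P G z l * (lam P G z l - del P G z l) := by
  simp only [slope, squaredSymmetric, population, one_mul]

theorem kappa_squaredSymmetric : (squaredSymmetric P G z).kappa j l =
    nu P G z j * lam P G z j - nu P G z l * del P G z l := by
  simp only [kappa, squaredSymmetric, population, one_mul]

end SlopeKappa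

variable {S : EstimatingScheme p} {m : Fin p → ℝ}

/-- The scheme `S` can almost surely be linearized at the identity along the observations `x` with
sources `z`, and its estimators are measurable with errors of order `n^{-1/2}`. -/
structure IsAERegular (S : EstimatingScheme p) (P : Measure Ω) (m : Fin p → ℝ)
    (x z : ℕ → Ω → Fin p → ℝ) : Prop where
  measurable_obs : ∀ i, Measurable (x i)
  measurable_source : ∀ i, Measurable (z i)
  continuous_deriv : Continuous (deriv S.G)
  continuous_weight : ∀ n j,
    Continuous fun q : (Fin n → Fin p → ℝ) × (Fin p → ℝ) => S.weight n q.1 q.2 j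
  isRootBounded : IsRootBounded P fun n ω => fluctuation S.G m (fun i => z i ω) n
  ae_isRegular : ∀ᵐ ω ∂P, S.IsRegular m (fun i => z i ω) fun n => firstObs x n ω

namespace IsAERegular

theorem isConsistentSolution (h : S.IsAERegular P m x z) (hD : ∀ j l, j < l → S.slope j l ≠ 0) :
    IsConsistentSolution P x
      (fun _ X Γ => IsWhitening X Γ ∧ ∀ j l, j < l → S.critRes X Γ j l = 0) S.newtonLimit := by
  refine ⟨fun n => measurable_newtonLimit h.continuous_deriv (h.continuous_weight n), ?_⟩
  filter_upwards [h.ae_isRegular] with ω hω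
  obtain ⟨hzero, hlim, -⟩ := hω.newtonLimit_spec hD
  refine ⟨hzero.mono fun n hn => isWhitening_and_critRes_eq_zero hD hn, fun j l => ?_⟩
  simpa only [Matrix.one_apply, idRows_apply, eq_comm] using
    tendsto_pi_nhds.1 (tendsto_pi_nhds.1 hlim j) l

theorem measurable_newtonLimit (h : S.IsAERegular P m x z) (n : ℕ) (j l : Fin p) :
    Measurable fun ω => S.newtonLimit n (firstObs x n ω) j l :=
  (EstimatingScheme.measurable_newtonLimit h.continuous_deriv (h.continuous_weight n) j l).comp
    (measurable_firstObs h.measurable_obs n)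

theorem measurable_sampleCov (h : S.IsAERegular P m x z) (n : ℕ) (j l : Fin p) :
    Measurable fun ω => sampleCov (firstObs x n ω) j l :=
  (continuous_sampleCov j l).measurable.comp (measurable_firstObs h.measurable_obs n)

theorem measurable_srcT (h : S.IsAERegular P m x z) (a : ℝ) (n : ℕ) (j l : Fin p) :
    Measurable fun ω => srcT S.G a (firstObs z n ω) j l :=
  (continuous_srcT h.continuous_deriv a j l).measurable.comp
    (measurable_firstObs h.measurable_source n)

theorem isLittleOP_of_ae_isLittleO [IsFiniteMeasure P] (h : S.IsAERegular P m x z)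
    {R R' : ℕ → Ω → ℝ} (hR : ∀ n, Measurable (R n))
    (ho : ∀ᵐ ω ∂P, (fun n => R n ω) =o[atTop] fluctuation S.G m fun i => z i ω)
    (hR' : ∀ n ω, R' n ω = √n * R n ω) : IsLittleOP P R' := by
  rw [show R' = fun (n : ℕ) ω => √n * R n ω from funext₂ hR']
  exact isLittleOP_sqrt_mul_of_ae_isLittleO hR
    (measurable_fluctuation h.continuous_deriv h.measurable_source m) h.isRootBounded ho

theorem isLittleOP_diag [IsFiniteMeasure P] (h : S.IsAERegular P m x z)
    (hD : ∀ j l, j < l → S.slope j l ≠ 0) (j : Fin p) :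
    IsLittleOP P fun n ω => √n * (S.newtonLimit n (firstObs x n ω) j j - 1) -
      (-(1 / 2) * (√n * (sampleCov (firstObs x n ω) j j - 1))) :=
  h.isLittleOP_of_ae_isLittleO
    (fun n => ((h.measurable_newtonLimit n j j).sub_const _).sub
      (((h.measurable_sampleCov n j j).sub_const _).const_mul _))
    (h.ae_isRegular.mono fun _ hω => hω.isLittleO_newtonLimit_diag hD j) fun n ω => by
      simp only [Pi.sub_apply]
      ring

theorem isLittleOP_lower [IsFiniteMeasure P] (h : S.IsAERegular P m x z)
    (hD : ∀ j l, j < l → S.slope j l ≠ 0) {j l : Fin p} (hlj : l < j) :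
    IsLittleOP P fun n ω => √n * S.newtonLimit n (firstObs x n ω) j l -
      (-(√n * S.newtonLimit n (firstObs x n ω) l j) - √n * sampleCov (firstObs x n ω) j l) :=
  h.isLittleOP_of_ae_isLittleO
    (fun n => (h.measurable_newtonLimit n j l).sub
      ((h.measurable_newtonLimit n l j).neg.sub (h.measurable_sampleCov n j l)))
    (h.ae_isRegular.mono fun _ hω => hω.isLittleO_newtonLimit_lower hD hlj) fun n ω => by
      simp only [Pi.sub_apply, Pi.neg_apply]
      ring

theorem isLittleOP_upper [IsFiniteMeasure P] (h : S.IsAERegular P m x z)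
    (hD : ∀ j l, j < l → S.slope j l ≠ 0) {j l : Fin p} (hjl : j < l) :
    IsLittleOP P fun n ω => √n * S.newtonLimit n (firstObs x n ω) j l -
      (S.a j * (√n * srcT S.G (m j) (firstObs z n ω) j l) -
        S.c * (S.a l * (√n * srcT S.G (m l) (firstObs z n ω) l j)) -
        S.kappa j l * (√n * sampleCov (firstObs x n ω) j l)) / S.slope j l :=
  h.isLittleOP_of_ae_isLittleO
    (fun n => (h.measurable_newtonLimit n j l).sub
      (((((h.measurable_srcT (m j) n j l).const_mul _).sub
        (((h.measurable_srcT (m l) n l j).const_mul _).const_mul _)).sub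
          ((h.measurable_sampleCov n j l).const_mul _)).div_const _))
    (h.ae_isRegular.mono fun _ hω => hω.isLittleO_newtonLimit_upper hD hjl) fun n ω => by
      simp only [Pi.sub_apply]
      ring

theorem isLittleOP_offDiag [IsFiniteMeasure P] (h : S.IsAERegular P m x z) (hc : S.c = 1)
    (hD : ∀ j l, l ≠ j → S.slope j l ≠ 0) {T : ℕ → Fin p → Fin p → Ω → ℝ}
    (hTm : ∀ n j l, Measurable (T n j l))
    (hT : ∀ᵐ ω ∂P, ∀ j l, l ≠ j → (fun n => T n j l ω -
      S.a j * srcT S.G (m j) (fun i : Fin n => z i ω) j l) =o[atTop]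
        fluctuation S.G m fun i => z i ω)
    {j l : Fin p} (hlj : l ≠ j) :
    IsLittleOP P fun n ω => √n * S.newtonLimit n (firstObs x n ω) j l -
      (√n * T n j l ω - √n * T n l j ω -
        S.kappa j l * (√n * sampleCov (firstObs x n ω) j l)) / S.slope j l := by
  refine h.isLittleOP_of_ae_isLittleO (R := fun n ω => S.newtonLimit n (firstObs x n ω) j l -
      (T n j l ω - T n l j ω - S.kappa j l * sampleCov (firstObs x n ω) j l) / S.slope j l)
    (fun n => (h.measurable_newtonLimit n j l).sub ((((hTm n j l).sub (hTm n l j)).sub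
      ((h.measurable_sampleCov n j l).const_mul _)).div_const _)) ?_ fun n ω => by ring
  filter_upwards [h.ae_isRegular, hT] with ω hω hTω
  refine ((hω.isLittleO_newtonLimit_offDiag hc hD hlj).sub (((hTω j l hlj).sub
    (hTω l j hlj.symm)).const_mul_left (S.slope j l)⁻¹)).congr_left fun n => ?_
  ring

end IsAERegular

end EstimatingScheme

open EstimatingScheme

variable [IsProbabilityMeasure P] {G : ℝ → ℝ} {loc : Fin p → ℝ}

namespace IsICSample

theorem isAERegular_population (hmodel : IsICSample P loc 1 x z) (hG : ContDiff ℝ 2 G)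
    (hA2 : IsStandardized P (z 0)) (hA3 : HasMoments P G (z 0))
    (hdom : IsLocallyDominated P G (z 0)) {c : ℝ}
    {w : ∀ n : ℕ, (Fin n → Fin p → ℝ) → (Fin p → ℝ) → Fin p → ℝ} {a : Fin p → ℝ}
    (hwc : ∀ n j, Continuous fun q : (Fin n → Fin p → ℝ) × (Fin p → ℝ) => w n q.1 q.2 j)
    (hw : ∀ᵐ ω ∂P, ∀ j, ∃ L : (Fin p → ℝ) →L[ℝ] ℝ, HasUnifStrictFDerivAt atTop
      (fun n γ => w n (firstObs x n ω) γ j) (a j) L (Pi.single j 1)) :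
    (population P G (z 0) c w a).IsAERegular P (mu P G (z 0)) x z where
  measurable_obs := hmodel.measurable_obs
  measurable_source := hmodel.measurable
  continuous_deriv := (contDiff_one_deriv hG).continuous
  continuous_weight := hwc
  isRootBounded :=
    hmodel.isRootBounded_fluctuation (contDiff_one_deriv hG).continuous hA2 hA3 _
  ae_isRegular := by
    filter_upwards [hmodel.ae_isRegularSequence hG hA2 hA3 hdom, hw] with ω hω hwω
    exact ⟨hω, hmodel.isTranslate ω, hwω⟩

theorem isAERegular_deflation (hmodel : IsICSample P loc 1 x z) (hG : ContDiff ℝ 2 G)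
    (hA2 : IsStandardized P (z 0)) (hA3 : HasMoments P G (z 0))
    (hdom : IsLocallyDominated P G (z 0)) :
    (deflation P G (z 0)).IsAERegular P (mu P G (z 0)) x z :=
  hmodel.isAERegular_population hG hA2 hA3 hdom (fun _ _ => continuous_const)
    (ae_of_all _ fun _ _ => ⟨0, .of_tendsto tendsto_const_nhds⟩)

theorem isAERegular_symmetric (hmodel : IsICSample P loc 1 x z) (hG : ContDiff ℝ 2 G)
    (hA2 : IsStandardized P (z 0)) (hA3 : HasMoments P G (z 0))
    (hdom : IsLocallyDominated P G (z 0)) :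
    (symmetric P G (z 0)).IsAERegular P (mu P G (z 0)) x z :=
  hmodel.isAERegular_population hG hA2 hA3 hdom (fun _ _ => continuous_const)
    (ae_of_all _ fun _ _ => ⟨0, .of_tendsto tendsto_const_nhds⟩)

theorem isAERegular_squaredSymmetric (hmodel : IsICSample P loc 1 x z) (hG : ContDiff ℝ 2 G)
    (hA2 : IsStandardized P (z 0)) (hA3 : HasMoments P G (z 0))
    (hdom : IsLocallyDominated P G (z 0)) :
    (squaredSymmetric P G (z 0)).IsAERegular P (mu P G (z 0)) x z :=
  hmodel.isAERegular_population hG hA2 hA3 hdom (fun _ _ => continuous_hatG hG.continuous)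
    (hmodel.ae_hasUnifStrictFDerivAt_hatG hG hA2 hA3 hdom)

theorem isConsistentSolution_deflation (hmodel : IsICSample P loc 1 x z) (hG : ContDiff ℝ 2 G)
    (hA2 : IsStandardized P (z 0)) (hA3 : HasMoments P G (z 0))
    (hdom : IsLocallyDominated P G (z 0))
    (hD : ∀ j l, j < l → (deflation P G (z 0)).slope j l ≠ 0) :
    IsConsistentSolution P x (fun _ X Γ => IsDeflationSolution G X Γ)
      (deflation P G (z 0)).newtonLimit :=
  ((hmodel.isAERegular_deflation hG hA2 hA3 hdom).isConsistentSolution hD).mono <|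
    ae_of_all _ fun _ _ => .of_forall fun _ hn => hn.1.isDeflationSolution fun j l hjl => by
      simpa [critRes, deflation, population] using hn.2 j l hjl

theorem isConsistentSolution_symmetric (hmodel : IsICSample P loc 1 x z) (hG : ContDiff ℝ 2 G)
    (hA2 : IsStandardized P (z 0)) (hA3 : HasMoments P G (z 0))
    (hdom : IsLocallyDominated P G (z 0)) (hnu : ∀ j, nu P G (z 0) j ≠ 0)
    (hD : ∀ j l, j < l → (symmetric P G (z 0)).slope j l ≠ 0) :
    IsConsistentSolution P x (fun _ X Γ => IsSymmetricSolution G X Γ)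
      (symmetric P G (z 0)).newtonLimit := by
  refine ((hmodel.isAERegular_symmetric hG hA2 hA3 hdom).isConsistentSolution hD).mono ?_
  filter_upwards [hmodel.ae_hasUnifStrictFDerivAt_hatG hG hA2 hA3 hdom] with ω hω hlim
  have hsign : ∀ᶠ n in atTop, ∀ j, Real.sign (hatG G (firstObs x n ω)
      ((symmetric P G (z 0)).newtonLimit n (firstObs x n ω) j)) = sgn P G (z 0) j := by
    refine eventually_all.2 fun j => ?_
    obtain ⟨L, hL⟩ := hω j
    refine eventually_sign_eq (hL.tendsto_comp (tendsto_pi_nhds.2 fun l => ?_)) (hnu j)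
    simpa only [Matrix.one_apply, Pi.single_apply, eq_comm] using hlim j l
  filter_upwards [hsign] with n hn hcrit
  refine ⟨fun j l => ?_, hcrit.1⟩
  rw [hn j, hn l, mul_comm, mul_comm _ (sgn P G (z 0) l)]
  exact weight_mul_eq_of_critRes_eq_zero rfl hcrit.2 j l

theorem isConsistentSolution_squaredSymmetric (hmodel : IsICSample P loc 1 x z)
    (hG : ContDiff ℝ 2 G) (hA2 : IsStandardized P (z 0)) (hA3 : HasMoments P G (z 0))
    (hdom : IsLocallyDominated P G (z 0))
    (hD : ∀ j l, j < l → (squaredSymmetric P G (z 0)).slope j l ≠ 0) :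
    IsConsistentSolution P x (fun _ X Γ => IsSquaredSymmetricSolution G X Γ)
      (squaredSymmetric P G (z 0)).newtonLimit := by
  refine ((hmodel.isAERegular_squaredSymmetric hG hA2 hA3 hdom).isConsistentSolution hD).mono <|
    ae_of_all _ fun _ _ => .of_forall fun _ hn => ⟨fun j l => ?_, hn.1⟩
  simp only [hatT2, dotProduct_smul, smul_eq_mul]
  exact weight_mul_eq_of_critRes_eq_zero rfl hn.2 j l

theorem ae_isLittleO_srcT2_sub (hmodel : IsICSample P loc 1 x z) (hG : ContDiff ℝ 2 G)
    (hA2 : IsStandardized P (z 0)) (hA3 : HasMoments P G (z 0))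
    (hdom : IsLocallyDominated P G (z 0)) :
    ∀ᵐ ω ∂P, ∀ j l, l ≠ j → (fun n => srcT2 G (mu P G (z 0) j) (firstObs z n ω) j l -
      nu P G (z 0) j * srcT G (mu P G (z 0) j) (firstObs z n ω) j l)
        =o[atTop] fluctuation G (mu P G (z 0)) fun i => z i ω := by
  choose L hL using ae_hasUnifStrictFDerivAt_avgG hG hmodel hA2 hA3 hdom
  filter_upwards [ae_all_iff.2 hL] with ω hω j l hlj
  have hnu : (fun n => avgG G (fun i => z i ω) n (axis j) - nu P G (z 0) j)
      =o[atTop] fun _ => (1 : ℝ) := by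
    rw [isLittleO_one_iff]
    simpa only [sub_self] using
      ((hω j).tendsto_comp tendsto_const_nhds).sub_const (nu P G (z 0) j)
  have hsrcT := isBigO_srcT_fluctuation G (mu P G (z 0)) (fun i => z i ω) hlj
  refine (hnu.smul_isBigO hsrcT).congr (fun n => ?_) fun n => one_smul ℝ _
  have havg : avgG G (fun i => z i ω) n (axis j) =
      (n : ℝ)⁻¹ * ∑ i, G (firstObs z n ω i j) := by
    simp [avgG, centredProj, axis, empMean_eq_smul_sum_fin, firstObs]
  rw [havg, smul_eq_mul, sub_mul]
  rfl

theorem isLittleOP_deflation (hmodel : IsICSample P loc 1 x z) (hG : ContDiff ℝ 2 G)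
    (hA2 : IsStandardized P (z 0)) (hA3 : HasMoments P G (z 0))
    (hdom : IsLocallyDominated P G (z 0))
    (hD : ∀ j l, j < l → (deflation P G (z 0)).slope j l ≠ 0) {j l : Fin p} (hjl : j < l) :
    IsLittleOP P fun n ω => √n * (deflation P G (z 0)).newtonLimit n (firstObs x n ω) j l -
      (√n * srcT G (mu P G (z 0) j) (firstObs z n ω) j l -
          lam P G (z 0) j * (√n * sampleCov (firstObs x n ω) j l)) /
        (lam P G (z 0) j - del P G (z 0) j) := by
  have hup := (hmodel.isAERegular_deflation hG hA2 hA3 hdom).isLittleOP_upper hD hjl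
  rw [slope_deflation, kappa_deflation] at hup
  simpa only [deflation, population, one_mul, zero_mul, sub_zero] using hup

theorem isLittleOP_symmetric (hmodel : IsICSample P loc 1 x z) (hG : ContDiff ℝ 2 G)
    (hA2 : IsStandardized P (z 0)) (hA3 : HasMoments P G (z 0))
    (hdom : IsLocallyDominated P G (z 0))
    (hD : ∀ j l, l ≠ j → (symmetric P G (z 0)).slope j l ≠ 0) {j l : Fin p} (hlj : l ≠ j) :
    IsLittleOP P fun n ω => √n * (symmetric P G (z 0)).newtonLimit n (firstObs x n ω) j l -
      (√n * srcT G (mu P G (z 0) j) (firstObs z n ω) j l * sgn P G (z 0) j -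
          √n * srcT G (mu P G (z 0) l) (firstObs z n ω) l j * sgn P G (z 0) l -
          (lam P G (z 0) j * sgn P G (z 0) j - del P G (z 0) l * sgn P G (z 0) l) *
            (√n * sampleCov (firstObs x n ω) j l)) /
        ((lam P G (z 0) j - del P G (z 0) j) * sgn P G (z 0) j +
          (lam P G (z 0) l - del P G (z 0) l) * sgn P G (z 0) l) := by
  have hreg := hmodel.isAERegular_symmetric hG hA2 hA3 hdom
  simpa only [slope_symmetric, kappa_symmetric, mul_assoc] using
    hreg.isLittleOP_offDiag rfl hD
      (T := fun n j l ω => srcT G (mu P G (z 0) j) (firstObs z n ω) j l * sgn P G (z 0) j)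
      (fun n j l => (hreg.measurable_srcT (mu P G (z 0) j) n j l).mul_const _)
      (ae_of_all _ fun ω j l _ => (isLittleO_zero _ _).congr_left fun n =>
        (sub_eq_zero.2 (mul_comm _ _)).symm) hlj

theorem isLittleOP_squaredSymmetric (hmodel : IsICSample P loc 1 x z) (hG : ContDiff ℝ 2 G)
    (hA2 : IsStandardized P (z 0)) (hA3 : HasMoments P G (z 0))
    (hdom : IsLocallyDominated P G (z 0))
    (hD : ∀ j l, l ≠ j → (squaredSymmetric P G (z 0)).slope j l ≠ 0) {j l : Fin p}
    (hlj : l ≠ j) :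
    IsLittleOP P fun n ω =>
      √n * (squaredSymmetric P G (z 0)).newtonLimit n (firstObs x n ω) j l -
      (√n * srcT2 G (mu P G (z 0) j) (firstObs z n ω) j l -
          √n * srcT2 G (mu P G (z 0) l) (firstObs z n ω) l j +
          (nu P G (z 0) l * del P G (z 0) l - nu P G (z 0) j * lam P G (z 0) j) *
            (√n * sampleCov (firstObs x n ω) j l)) /
        (nu P G (z 0) j * (lam P G (z 0) j - del P G (z 0) j) +
          nu P G (z 0) l * (lam P G (z 0) l - del P G (z 0) l)) := by
  have hsrcT2 : ∀ n j l, Measurable fun ω => srcT2 G (mu P G (z 0) j) (firstObs z n ω) j l :=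
    fun n j l => (continuous_srcT2 hG.continuous (contDiff_one_deriv hG).continuous _ j
      l).measurable.comp (measurable_firstObs hmodel.measurable n)
  have hoff := (hmodel.isAERegular_squaredSymmetric hG hA2 hA3 hdom).isLittleOP_offDiag rfl hD
    hsrcT2 (hmodel.ae_isLittleO_srcT2_sub hG hA2 hA3 hdom) hlj
  rw [slope_squaredSymmetric, kappa_squaredSymmetric] at hoff
  convert hoff using 6
  ring

end IsICSample

end Estimators

section Denominators

theorem add_ne_zero_of_subsingleton {ι : Type*} {f : ι → ℝ} (hf : ∀ i, 0 ≤ f i)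
    (hzero : {i | f i = 0}.Subsingleton) {i j : ι} (hji : j ≠ i) : f i + f j ≠ 0 := by
  intro hsum
  obtain ⟨hi, hj⟩ := (add_eq_zero_iff_of_nonneg (hf i) (hf j)).1 hsum
  exact hji (hzero hj hi)

theorem mul_sign_nonneg_of_mul_nonneg {a b : ℝ} (h : 0 ≤ a * b) : 0 ≤ b * Real.sign a := by
  rcases lt_trichotomy a 0 with ha | rfl | ha
  · rw [Real.sign_of_neg ha, mul_neg_one, neg_nonneg]
    exact nonpos_of_mul_nonneg_right h ha
  · simp
  · rw [Real.sign_of_pos ha, mul_one]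
    exact nonneg_of_mul_nonneg_right h ha

end Denominators

end FastICA

end

open FastICA EstimatingScheme in
theorem theorem1_general {Ω : Type*} [MeasurableSpace Ω] (P : Measure Ω) [IsProbabilityMeasure P]
    {p : ℕ} (G : ℝ → ℝ) (hG : ContDiff ℝ 2 G)
    (loc : Fin p → ℝ) (x z : ℕ → Ω → Fin p → ℝ)
    (hmodel : IsICSample P loc 1 x z)
    (hA2 : IsStandardized P (z 0))
    (hA3 : HasMoments P G (z 0))
    (hdom : IsLocallyDominated P G (z 0)) :
    ((∀ j l : Fin p, j < l → lam P G (z 0) j ≠ del P G (z 0) j) →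
      ∃ est : ∀ n : ℕ, (Fin n → Fin p → ℝ) → Matrix (Fin p) (Fin p) ℝ,
        IsConsistentSolution P x (fun _ X Γ => IsDeflationSolution G X Γ) est ∧
        (∀ j l, l < j → IsLittleOP P fun n ω =>
          √n * est n (firstObs x n ω) j l -
            (-(√n * est n (firstObs x n ω) l j) - √n * sampleCov (firstObs x n ω) j l)) ∧
        (∀ j, IsLittleOP P fun n ω =>
          √n * (est n (firstObs x n ω) j j - 1) -
            (-(1 / 2) * (√n * (sampleCov (firstObs x n ω) j j - 1)))) ∧
        (∀ j l, j < l → IsLittleOP P fun n ω =>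
          √n * est n (firstObs x n ω) j l -
            (√n * srcT G (mu P G (z 0) j) (firstObs z n ω) j l -
                lam P G (z 0) j * (√n * sampleCov (firstObs x n ω) j l)) /
              (lam P G (z 0) j - del P G (z 0) j))) ∧
    ((∀ j, nu P G (z 0) j ≠ 0) →
      (∀ j l, l ≠ j → (lam P G (z 0) j - del P G (z 0) j) * sgn P G (z 0) j +
        (lam P G (z 0) l - del P G (z 0) l) * sgn P G (z 0) l ≠ 0) →
      ∃ est : ∀ n : ℕ, (Fin n → Fin p → ℝ) → Matrix (Fin p) (Fin p) ℝ,
        IsConsistentSolution P x (fun _ X Γ => IsSymmetricSolution G X Γ) est ∧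
        (∀ j, IsLittleOP P fun n ω =>
          √n * (est n (firstObs x n ω) j j - 1) -
            (-(1 / 2) * (√n * (sampleCov (firstObs x n ω) j j - 1)))) ∧
        (∀ j l, l ≠ j → IsLittleOP P fun n ω =>
          √n * est n (firstObs x n ω) j l -
            (√n * srcT G (mu P G (z 0) j) (firstObs z n ω) j l * sgn P G (z 0) j -
                √n * srcT G (mu P G (z 0) l) (firstObs z n ω) l j * sgn P G (z 0) l -
                (lam P G (z 0) j * sgn P G (z 0) j - del P G (z 0) l * sgn P G (z 0) l) *
                  (√n * sampleCov (firstObs x n ω) j l)) /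
              ((lam P G (z 0) j - del P G (z 0) j) * sgn P G (z 0) j +
                (lam P G (z 0) l - del P G (z 0) l) * sgn P G (z 0) l))) ∧
    ((∀ j l, l ≠ j → nu P G (z 0) j * (lam P G (z 0) j - del P G (z 0) j) +
        nu P G (z 0) l * (lam P G (z 0) l - del P G (z 0) l) ≠ 0) →
      ∃ est : ∀ n : ℕ, (Fin n → Fin p → ℝ) → Matrix (Fin p) (Fin p) ℝ,
        IsConsistentSolution P x (fun _ X Γ => IsSquaredSymmetricSolution G X Γ) est ∧
        (∀ j, IsLittleOP P fun n ω =>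
          √n * (est n (firstObs x n ω) j j - 1) -
            (-(1 / 2) * (√n * (sampleCov (firstObs x n ω) j j - 1)))) ∧
        (∀ j l, l ≠ j → IsLittleOP P fun n ω =>
          √n * est n (firstObs x n ω) j l -
            (√n * srcT2 G (mu P G (z 0) j) (firstObs z n ω) j l -
                √n * srcT2 G (mu P G (z 0) l) (firstObs z n ω) l j +
                (nu P G (z 0) l * del P G (z 0) l - nu P G (z 0) j * lam P G (z 0) j) *
                  (√n * sampleCov (firstObs x n ω) j l)) /
              (nu P G (z 0) j * (lam P G (z 0) j - del P G (z 0) j) +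
                nu P G (z 0) l * (lam P G (z 0) l - del P G (z 0) l)))) := by
  refine ⟨fun hne => ?_, fun hnu hne => ?_, fun hne => ?_⟩
  · have hD : ∀ j l, j < l → (deflation P G (z 0)).slope j l ≠ 0 := fun j l hjl => by
      rw [slope_deflation, sub_ne_zero]
      exact hne j l hjl
    have hreg := hmodel.isAERegular_deflation hG hA2 hA3 hdom
    exact ⟨_, hmodel.isConsistentSolution_deflation hG hA2 hA3 hdom hD,
      fun _ _ => hreg.isLittleOP_lower hD, hreg.isLittleOP_diag hD,
      fun _ _ => hmodel.isLittleOP_deflation hG hA2 hA3 hdom hD⟩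
  · simp only [← slope_symmetric] at hne
    have hD : ∀ j l, j < l → (symmetric P G (z 0)).slope j l ≠ 0 := fun j l hjl => hne j l hjl.ne'
    exact ⟨_, hmodel.isConsistentSolution_symmetric hG hA2 hA3 hdom hnu hD,
      (hmodel.isAERegular_symmetric hG hA2 hA3 hdom).isLittleOP_diag hD,
      fun _ _ => hmodel.isLittleOP_symmetric hG hA2 hA3 hdom hne⟩
  · simp only [← slope_squaredSymmetric] at hne
    have hD : ∀ j l, j < l → (squaredSymmetric P G (z 0)).slope j l ≠ 0 :=
      fun j l hjl => hne j l hjl.ne'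
    exact ⟨_, hmodel.isConsistentSolution_squaredSymmetric hG hA2 hA3 hdom hD,
      (hmodel.isAERegular_squaredSymmetric hG hA2 hA3 hdom).isLittleOP_diag hD,
      fun _ _ => hmodel.isLittleOP_squaredSymmetric hG hA2 hA3 hdom hne⟩

open FastICA in
theorem theorem1 {Ω : Type*} [MeasurableSpace Ω] (P : Measure Ω) [IsProbabilityMeasure P]
    {p : ℕ} (G : ℝ → ℝ) (hG : IsAdmissible G)
    (loc : Fin p → ℝ) (x z : ℕ → Ω → Fin p → ℝ)
    (hmodel : IsICSample P loc 1 x z)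
    (hA1 : AtMostOneGaussian P (z 0))
    (hA2 : IsStandardized P (z 0))
    (hA3 : HasMoments P G (z 0))
    (hdom : IsLocallyDominated P G (z 0))
    (hnonneg : ∀ j, 0 ≤ nu P G (z 0) j * (lam P G (z 0) j - del P G (z 0) j))
    (hzero : {j | nu P G (z 0) j * (lam P G (z 0) j - del P G (z 0) j) = 0}.Subsingleton) :
    -- (i) deflation-based
    ((∀ j l : Fin p, j < l → lam P G (z 0) j ≠ del P G (z 0) j) →
      ∃ est : ∀ n : ℕ, (Fin n → Fin p → ℝ) → Matrix (Fin p) (Fin p) ℝ,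
        IsConsistentSolution P x (fun _ X Γ => IsDeflationSolution G X Γ) est ∧
        (∀ j l, l < j → IsLittleOP P fun n ω =>
          √n * est n (firstObs x n ω) j l -
            (-(√n * est n (firstObs x n ω) l j) - √n * sampleCov (firstObs x n ω) j l)) ∧
        (∀ j, IsLittleOP P fun n ω =>
          √n * (est n (firstObs x n ω) j j - 1) -
            (-(1 / 2) * (√n * (sampleCov (firstObs x n ω) j j - 1)))) ∧
        (∀ j l, j < l → IsLittleOP P fun n ω =>
          √n * est n (firstObs x n ω) j l -
            (√n * srcT G (mu P G (z 0) j) (firstObs z n ω) j l -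
                lam P G (z 0) j * (√n * sampleCov (firstObs x n ω) j l)) /
              (lam P G (z 0) j - del P G (z 0) j))) ∧
    -- (ii) symmetric
    ((∀ j, nu P G (z 0) j ≠ 0) →
      ∃ est : ∀ n : ℕ, (Fin n → Fin p → ℝ) → Matrix (Fin p) (Fin p) ℝ,
        IsConsistentSolution P x (fun _ X Γ => IsSymmetricSolution G X Γ) est ∧
        (∀ j, IsLittleOP P fun n ω =>
          √n * (est n (firstObs x n ω) j j - 1) -
            (-(1 / 2) * (√n * (sampleCov (firstObs x n ω) j j - 1)))) ∧
        (∀ j l, l ≠ j → IsLittleOP P fun n ω =>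
          √n * est n (firstObs x n ω) j l -
            (√n * srcT G (mu P G (z 0) j) (firstObs z n ω) j l * sgn P G (z 0) j -
                √n * srcT G (mu P G (z 0) l) (firstObs z n ω) l j * sgn P G (z 0) l -
                (lam P G (z 0) j * sgn P G (z 0) j - del P G (z 0) l * sgn P G (z 0) l) *
                  (√n * sampleCov (firstObs x n ω) j l)) /
              ((lam P G (z 0) j - del P G (z 0) j) * sgn P G (z 0) j +
                (lam P G (z 0) l - del P G (z 0) l) * sgn P G (z 0) l))) ∧
    -- (iii) squared symmetric
    (∃ est : ∀ n : ℕ, (Fin n → Fin p → ℝ) → Matrix (Fin p) (Fin p) ℝ,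
        IsConsistentSolution P x (fun _ X Γ => IsSquaredSymmetricSolution G X Γ) est ∧
        (∀ j, IsLittleOP P fun n ω =>
          √n * (est n (firstObs x n ω) j j - 1) -
            (-(1 / 2) * (√n * (sampleCov (firstObs x n ω) j j - 1)))) ∧
        (∀ j l, l ≠ j → IsLittleOP P fun n ω =>
          √n * est n (firstObs x n ω) j l -
            (√n * srcT2 G (mu P G (z 0) j) (firstObs z n ω) j l -
                √n * srcT2 G (mu P G (z 0) l) (firstObs z n ω) l j +
                (nu P G (z 0) l * del P G (z 0) l - nu P G (z 0) j * lam P G (z 0) j) *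
                  (√n * sampleCov (firstObs x n ω) j l)) /
              (nu P G (z 0) j * (lam P G (z 0) j - del P G (z 0) j) +
                nu P G (z 0) l * (lam P G (z 0) l - del P G (z 0) l)))) := by
  obtain ⟨hdefl, hsym, hsq⟩ := theorem1_general P G hG.contDiff loc x z hmodel hA2 hA3 hdom
  refine ⟨hdefl, fun hnu => hsym hnu fun j l hlj => ?_,
    hsq fun j l hlj => add_ne_zero_of_subsingleton hnonneg hzero hlj⟩
  refine add_ne_zero_of_subsingleton (f := fun j => (lam P G (z 0) j - del P G (z 0) j) *
    sgn P G (z 0) j) (fun k => mul_sign_nonneg_of_mul_nonneg (hnonneg k))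
    (hzero.anti fun k hk => ?_) hlj
  exact mul_eq_zero_of_right _
    ((mul_eq_zero.1 hk).resolve_right (Real.sign_eq_zero_iff.not.2 (hnu k)))
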